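/- **Setting.** Let $R$ be a $d$-dimensional normal noetherian local domain with maximal ideal $M$ and quotient field $L$. Let $I$ be a nonzero $M$-primary ideal of $R$ which is normal, i.e. every power $I^n$ ($n\ge 1$) is complete: it is an intersection of contractions to $R$ of ideals of valuation rings of $L$ containing $R$. Let $Z$ be an indeterminate over $L$ and let $E=R[IZ]=\bigoplus_{n\ge 0}I^nZ^n$ be the Rees ring. *Dicritical divisors.* Let $\mathfrak W(R,I)$ be the set of all localizations, at prime ideals, of the rings $R[Ix^{-1}]\subset L$ with $0\ne x\in I$. The set $\mathfrak D(R,I)$ of dicritical divisors of $I$ consists of the localizations $T$, at prime ideals, of the integral closures in $L$ of rings $S$ such that $S\in\mathfrak W(R,I)$ is one-dimensional and dominates $R$, and $T$ dominates $S$. It is a nonempty finite set of discrete valuation rings; let $V_1,\dots,V_h$ be its distinct members. *Values.* $V_j(x)$ is the value of $x$ under the valuation of $V_j$ (with $V_j(0)=\infty$), and for an ideal $J$ of $R$, $V_j(J)=\min\{V_j(x):x\in J\}$. The $(R,I)$-extension $W_j$ of $V_j$ is the valuation ring of the valuation of $L(Z)$ given on nonzero elements of $E$ by $\sum_n f_nZ^n\mapsto\min\{V_j(f_n)-nV_j(I):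 f_n\neq 0\}$ (where $f_n\in I^n$). Then $E\subset W_j$. Put $P^*_j=E\cap M(W_j)$, where $M(W_j)$ is the maximal ideal of $W_j$, and $\Lambda'=\{j:\dim(E/P^*_j)=d\}$. *Reductions.* An ideal $J\subset K$ is a reduction of an ideal $K$ if $JK^n=K^{n+1}$ for some $n\ge0$. **Theorem.** 1. $P^*_1,\dots,P^*_h$ are pairwise distinct and are exactly the minimal primes of $ME$. Each $P^*_j$ has height $1$, and $\max_j\dim(E/P^*_j)=d=\dim(E)-1$. 2. For every $j$ and every $x\in I$: $V_j(x)=V_j(I)$ if and only if $xZ\notin P^*_j$. 3. If $x_1,\dots,x_d\in I$ and $(x_1,\dots,x_d)R$ is a reduction of $I$, then $V_j(x_i)=V_j(I)$ for all $1\le i\le d$ and all $j\in\Lambda'$. 4. If $d=1$ then $h=1$ and $\Lambda'=\{1\}$. If $d=2$ then $\Lambda'=\{1,\dots,h\}$. 5. If $d=1$ then for every $x\in I$: $V_1(x)=V_1(I)$ if and only if $xR$ is a reduction of $I$. 6. For every integer $r\ge1$ there exist an integer $s\ge1$ and elements $x_1,\dots,x_d\in I^{rs}$ such that for every integer $t\ge1$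 the ideal $(x_1^t,\dots,x_d^t)R$ is a reduction of $I^{rst}$. 7. If $r\ge1$ and $x_1\in I^r$ satisfy $V_j(x_1)=V_j(I^r)$ for all $j\in\Lambda'$, then there exist an integer $s\ge1$ and elements $x_2,\dots,x_d\in I^{rs}$ such that for every integer $t\ge1$ the ideal $(x_1^{st},x_2^t,\dots,x_d^t)R$ is a reduction of $I^{rst}$. 8. For every integer $r\ge1$ there exist an integer $s\ge1$ and $x_1\in I^{rs}$ such that $V_j(x_1)=V_j(I^{rs})$ for all $j\in\Lambda'$. 9. If $R/M$ is infinite, then there exist $x_1,\dots,x_d\in I$ such that $(x_1,\dots,x_d)R$ is a reduction of $I$. 10. If $R/M$ is infinite and $x_1\in I$ satisfies $V_j(x_1)=V_j(I)$ for all $j\in\Lambda'$, then there exist $x_2,\dots,x_d\in I$ such that $(x_1,\dots,x_d)R$ is a reduction of $I$. 11. For every $j$ there exists $x'_j\in I$ with $V_j(x'_j)=V_j(I)$. If $R/M$ is infinite, then there exists $x_1\in I$ with $V_j(x_1)=V_j(I)$ for all $1\le j\le h$. -/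

import Mathlib

open Polynomial

universe u v

noncomputable section

namespace Dicritical

section GaussExtension

variable {L : Type v} [Field L] {Γ : Type*} [LinearOrderedCommGroupWithZero Γ]

/-- The function `∑ aₙ Zⁿ ↦ max (v(aₙ) cⁿ)` on `L[Z]` (values are written multiplicatively, so the
minimum of an additive valuation is a maximum here). -/
def gaussFun (w : Valuation L Γ) (c : Γˣ) (f : L[X]) : Γ :=
  f.support.sup fun n => w (f.coeff n) * (c : Γ) ^ n

theorem gaussFun_zero (w : Valuation L Γ) (c : Γˣ) : gaussFun w c (0 : L[X]) = 0 := by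
  rw [gaussFun, support_zero, Finset.sup_empty]
  exact le_antisymm bot_le zero_le

theorem le_gaussFun (w : Valuation L Γ) (c : Γˣ) (f : L[X]) (n : ℕ) :
    w (f.coeff n) * (c : Γ) ^ n ≤ gaussFun w c f := by
  by_cases h : f.coeff n = 0
  · simp [h]
  · exact Finset.le_sup (f := fun n => w (f.coeff n) * (c : Γ) ^ n) (mem_support_iff.2 h)

theorem gaussFun_le {w : Valuation L Γ} {c : Γˣ} {f : L[X]} {b : Γ}
    (h : ∀ n, w (f.coeff n) * (c : Γ) ^ n ≤ b) : gaussFun w c f ≤ b :=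
  Finset.sup_le fun n _ => h n

theorem exists_gaussFun_eq (w : Valuation L Γ) (c : Γˣ) {f : L[X]} (hf : f ≠ 0) :
    ∃ n, f.coeff n ≠ 0 ∧ w (f.coeff n) * (c : Γ) ^ n = gaussFun w c f := by
  obtain ⟨n, hn, h⟩ := Finset.exists_mem_eq_sup f.support (support_nonempty.2 hf)
    fun n => w (f.coeff n) * (c : Γ) ^ n
  exact ⟨n, mem_support_iff.1 hn, h.symm⟩

theorem gaussFun_ne_zero (w : Valuation L Γ) (c : Γˣ) {f : L[X]} (hf : f ≠ 0) :
    gaussFun w c f ≠ 0 := by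
  obtain ⟨n, hn, h⟩ := exists_gaussFun_eq w c hf
  rw [← h]
  exact mul_ne_zero (by simpa using hn) (pow_ne_zero _ c.ne_zero)

theorem gaussFun_mul_le (w : Valuation L Γ) (c : Γˣ) (f g : L[X]) :
    gaussFun w c (f * g) ≤ gaussFun w c f * gaussFun w c g := by
  refine gaussFun_le fun n => ?_
  have hc : 0 < (c : Γ) ^ n := zero_lt_iff.2 (pow_ne_zero _ c.ne_zero)
  rw [← le_div_iff₀ hc, coeff_mul]
  refine w.map_sum_le fun p hp => ?_
  rw [le_div_iff₀ hc, ← Finset.HasAntidiagonal.mem_antidiagonal.1 hp, map_mul, pow_add, mul_mul_mul_comm]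
  exact mul_le_mul' (le_gaussFun w c f _) (le_gaussFun w c g _)

theorem gaussFun_mul (w : Valuation L Γ) (c : Γˣ) (f g : L[X]) :
    gaussFun w c (f * g) = gaussFun w c f * gaussFun w c g := by
  classical
  refine le_antisymm (gaussFun_mul_le w c f g) ?_
  by_cases hf : f = 0
  · simp [hf, gaussFun_zero]
  by_cases hg : g = 0
  · simp [hg, gaussFun_zero]
  have ef : ∃ n, w (f.coeff n) * (c : Γ) ^ n = gaussFun w c f :=
    (exists_gaussFun_eq w c hf).imp fun _ h => h.2
  have eg : ∃ n, w (g.coeff n) * (c : Γ) ^ n = gaussFun w c g :=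
    (exists_gaussFun_eq w c hg).imp fun _ h => h.2
  set i := Nat.find ef with hi
  set j := Nat.find eg with hj
  have hif : w (f.coeff i) * (c : Γ) ^ i = gaussFun w c f := Nat.find_spec ef
  have hjg : w (g.coeff j) * (c : Γ) ^ j = gaussFun w c g := Nat.find_spec eg
  have hlf : ∀ k < i, w (f.coeff k) * (c : Γ) ^ k < gaussFun w c f := fun k hk =>
    lt_of_le_of_ne (le_gaussFun w c f k) (Nat.find_min ef hk)
  have hlg : ∀ k < j, w (g.coeff k) * (c : Γ) ^ k < gaussFun w c g := fun k hk =>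
    lt_of_le_of_ne (le_gaussFun w c g k) (Nat.find_min eg hk)
  have hf0 := gaussFun_ne_zero w c hf
  have hg0 := gaussFun_ne_zero w c hg
  have hc : 0 < (c : Γ) ^ (i + j) := zero_lt_iff.2 (pow_ne_zero _ c.ne_zero)
  have hmain : w (f.coeff i * g.coeff j) * (c : Γ) ^ (i + j) =
      gaussFun w c f * gaussFun w c g := by
    rw [← hif, ← hjg, map_mul, pow_add, mul_mul_mul_comm]
  have hne : w (f.coeff i * g.coeff j) ≠ 0 := by
    intro h
    rw [h, zero_mul] at hmain
    exact mul_ne_zero hf0 hg0 hmain.symm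
  have hsum : w ((f * g).coeff (i + j)) = w (f.coeff i * g.coeff j) := by
    rw [coeff_mul, ← Finset.add_sum_erase _ _
      (Finset.HasAntidiagonal.mem_antidiagonal.2 (rfl : (i, j).1 + (i, j).2 = i + j))]
    refine w.map_add_eq_of_lt_left (w.map_sum_lt hne fun p hp => ?_)
    obtain ⟨hp1, hp2⟩ := Finset.mem_erase.1 hp
    have hp3 := Finset.HasAntidiagonal.mem_antidiagonal.1 hp2
    refine lt_of_mul_lt_mul_right' (a := (c : Γ) ^ (i + j)) ?_
    rw [hmain, ← hp3, map_mul, pow_add, mul_mul_mul_comm]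
    rcases lt_or_ge p.1 i with h | h
    · exact (mul_le_mul_right (le_gaussFun w c g _) _).trans_lt
        (mul_lt_mul_of_pos_right (hlf _ h) (zero_lt_iff.2 hg0))
    · have h2 : p.2 < j := by
        rcases h.lt_or_eq with h | h
        · omega
        · exfalso
          apply hp1
          ext
          · exact h.symm
          · simp only; omega
      exact (mul_le_mul_left (le_gaussFun w c f _) _).trans_lt
        (mul_lt_mul_of_pos_left (hlg _ h2) (zero_lt_iff.2 hf0))
  rw [← hmain, ← hsum]
  exact le_gaussFun w c _ _

/-- The valuation `∑ aₙ Zⁿ ↦ max (v(aₙ) cⁿ)` of `L[Z]`. -/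
def gaussPoly (w : Valuation L Γ) (c : Γˣ) : Valuation L[X] Γ where
  toFun := gaussFun w c
  map_zero' := gaussFun_zero w c
  map_one' := by
    refine le_antisymm (gaussFun_le fun n => ?_) ?_
    · rw [coeff_one]
      split_ifs with h
      · simp [h]
      · simp
    · simpa using le_gaussFun w c 1 0
  map_mul' := gaussFun_mul w c
  map_add_le_max' f g := by
    refine gaussFun_le fun n => ?_
    rw [coeff_add]
    rcases le_total (w (f.coeff n)) (w (g.coeff n)) with h | h
    · refine le_max_of_le_right (le_trans ?_ (le_gaussFun w c g n))
      exact mul_le_mul_left ((w.map_add _ _).trans (max_le h le_rfl)) _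
    · refine le_max_of_le_left (le_trans ?_ (le_gaussFun w c f n))
      exact mul_le_mul_left ((w.map_add _ _).trans (max_le le_rfl h)) _

/-- The extension to `L(Z)` of the valuation `∑ aₙ Zⁿ ↦ max (v(aₙ) cⁿ)` of `L[Z]`. -/
def gaussValuation (w : Valuation L Γ) (c : Γˣ) : Valuation (RatFunc L) Γ :=
  (gaussPoly w c).extendToLocalization (S := nonZeroDivisors L[X])
    (fun _ hf h => gaussFun_ne_zero w c (nonZeroDivisors.ne_zero hf) h) (RatFunc L)

theorem gaussValuation_algebraMap (w : Valuation L Γ) (c : Γˣ) (f : L[X]) :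
    gaussValuation w c (algebraMap L[X] (RatFunc L) f) =
      f.support.sup fun n => w (f.coeff n) * (c : Γ) ^ n :=
  (gaussPoly w c).extendToLocalization_apply_map_apply _ _ f

end GaussExtension

section Ideals

/-- `J` is a reduction of `I`. -/
def IsReduction {R : Type u} [CommRing R] (J I : Ideal R) : Prop :=
  J ≤ I ∧ ∃ n : ℕ, J * I ^ n = I ^ (n + 1)

variable {R : Type u} [CommRing R] (L : Type v) [Field L] [Algebra R L]

/-- `J` is a complete ideal of `R` (where `L` is the quotient field of `R`): it is an intersection
of contractions to `R` of ideals `F V` of the valuation rings `V` of `L` containing `R`. -/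
def IsCompleteIdeal (J : Ideal R) : Prop :=
  ∃ F : (V : ValuationSubring L) → Ideal V, ∀ a : R,
    a ∈ J ↔ ∀ (V : ValuationSubring L) (hV : ∀ r : R, algebraMap R L r ∈ V),
      (⟨algebraMap R L a, hV a⟩ : V) ∈ F V

/-- `I` is a normal ideal: all its (positive) powers are complete. -/
def IsNormalIdeal (I : Ideal R) : Prop :=
  ∀ n : ℕ, 1 ≤ n → IsCompleteIdeal L (I ^ n)

end Ideals

section Dicriticals

variable {R : Type u} [CommRing R] (L : Type v) [Field L] [Algebra R L]

/-- The subring `R[J x⁻¹]` of `L`. -/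
def blowupChart (J : Ideal R) (x : R) : Subring L :=
  (Algebra.adjoin R {z : L | ∃ y ∈ J, z = algebraMap R L y / algebraMap R L x}).toSubring

/-- `𝔙(A)`: the set of all localizations of `A` at its prime ideals, as subrings of `L`. -/
def modelicSpec {L : Type v} [Field L] (A : Subring L) : Set (LocalSubring L) :=
  {T | ∃ (P : Ideal A) (_ : P.IsPrime), T = LocalSubring.ofPrime A P}

/-- `𝔚(R, J)`: the modelic blowup of `R` at `J`. -/
def modelicBlowup (J : Ideal R) : Set (LocalSubring L) :=
  {T | ∃ x ∈ J, x ≠ 0 ∧ T ∈ modelicSpec (blowupChart L J x)}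

/-- `S^𝔑`: the members of `𝔙(S̄)` which dominate `S`, where `S̄` is the integral closure of `S` in
`L` (the quotient field of `S`). The order `≤` on `LocalSubring L` is domination. -/
def normalizationSet {L : Type v} [Field L] (S : LocalSubring L) : Set (LocalSubring L) :=
  {T | T ∈ modelicSpec (integralClosure S.toSubring L).toSubring ∧ S ≤ T}

variable [IsLocalRing R]

/-- `𝔚(R, J)^Δ_i`: the `i`-dimensional members of the modelic blowup which dominate `R`. -/
def dominatingBlowup (J : Ideal R) (i : ℕ) : Set (LocalSubring L) :=
  {T | T ∈ modelicBlowup L J ∧ ringKrullDim T.toSubring = i ∧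
    LocalSubring.range (algebraMap R L) ≤ T}

/-- `𝔇(R, J) = (𝔚(R, J)^Δ_1)^𝔑`: the dicritical set of `J` in `R`. -/
def dicriticalSet (J : Ideal R) : Set (LocalSubring L) :=
  {T | ∃ S ∈ dominatingBlowup L J 1, T ∈ normalizationSet S}

/-- The dicritical divisors of `J` in `R`, as valuation rings of `L`. -/
def dicriticalDivisors (J : Ideal R) : Set (ValuationSubring L) :=
  {V | V.toLocalSubring ∈ dicriticalSet L J}

variable {L} in
theorem algebraMap_mem_of_mem_dicriticalDivisors {J : Ideal R} {V : ValuationSubring L}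
    (hV : V ∈ dicriticalDivisors L J) (r : R) : algebraMap R L r ∈ V := by
  obtain ⟨S, ⟨_, _, hRS⟩, _, hSV⟩ := hV
  exact LocalSubring.toSubring_mono (hRS.trans hSV) ⟨r, rfl⟩

end Dicriticals

section Values

variable {R : Type u} [CommRing R] {L : Type v} [Field L] [Algebra R L]

/-- `V(x)` for `x ∈ R`, written multiplicatively. -/
def value (V : ValuationSubring L) (x : R) : V.ValueGroup :=
  V.valuation (algebraMap R L x)

theorem exists_value_max [IsNoetherianRing R] (V : ValuationSubring L)
    (hV : ∀ r : R, algebraMap R L r ∈ V) (I : Ideal R) :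
    ∃ x ∈ I, ∀ y ∈ I, value V y ≤ value V x := by
  obtain ⟨s, rfl⟩ := (isNoetherianRing_iff_ideal_fg R).1 inferInstance I
  rcases s.eq_empty_or_nonempty with rfl | hs
  · exact ⟨0, by simp, by simp⟩
  obtain ⟨x, hx, hmax⟩ := s.exists_max_image (value V) hs
  refine ⟨x, Ideal.subset_span hx, fun y hy => ?_⟩
  induction hy using Submodule.span_induction with
  | mem z hz => exact hmax z hz
  | zero => simp [value]
  | add a b _ _ ha hb =>
    simp only [value, map_add] at *
    exact (V.valuation.map_add _ _).trans (max_le ha hb)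
  | smul a b _ hb =>
    simp only [value, smul_eq_mul, map_mul] at *
    exact (mul_le_of_le_one_left' ((V.valuation_le_one_iff _).2 (hV a))).trans hb

open Classical in
/-- `V(I)`: the value at `V` of an element of `I` of minimal (additive) value, that is, of maximal
multiplicative value. Such an element exists if `R` is noetherian and contained in `V`. -/
def idealValue (V : ValuationSubring L) (I : Ideal R) : V.ValueGroup :=
  if h : ∃ x ∈ I, ∀ y ∈ I, value V y ≤ value V x then value V h.choose else 0

theorem idealValue_isGreatest [IsNoetherianRing R] (V : ValuationSubring L)
    (hV : ∀ r : R, algebraMap R L r ∈ V) (I : Ideal R) :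
    IsGreatest (value V '' (I : Set R)) (idealValue V I) := by
  have h := exists_value_max V hV I
  rw [idealValue, dif_pos h]
  refine ⟨⟨_, h.choose_spec.1, rfl⟩, ?_⟩
  rintro _ ⟨y, hy, rfl⟩
  exact h.choose_spec.2 y hy

open Classical in
/-- The inverse of `V(I)` (relevant only for `V(I) ≠ 0`, that is, for nonzero `I`). -/
def idealWeight (V : ValuationSubring L) (I : Ideal R) : V.ValueGroupˣ :=
  if h : idealValue V I = 0 then 1 else (Units.mk0 _ h)⁻¹

/-- The `(R, I)`-extension to `L(Z)` of the valuation of `V`; additively, it is given on the Rees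
ring by `∑ fₙ Zⁿ ↦ min (V(fₙ) - n V(I))`. -/
def reesValuation (V : ValuationSubring L) (I : Ideal R) : Valuation (RatFunc L) V.ValueGroup :=
  gaussValuation V.valuation (idealWeight V I)

/-- The `(R, I)`-extension `W` of `V` to `L(Z)`. -/
def reesExtension (V : ValuationSubring L) (I : Ideal R) : ValuationSubring (RatFunc L) :=
  (reesValuation V I).valuationSubring

variable (L) in
/-- The inclusion of the Rees ring `E = R[IZ]` in `L(Z)`. -/
def reesToRatFunc (I : Ideal R) : reesAlgebra I →+* RatFunc L :=
  ((algebraMap L[X] (RatFunc L)).comp (mapRingHom (algebraMap R L))).comp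
    (reesAlgebra I).val.toRingHom

theorem value_mul_idealWeight_pow_le_one [IsNoetherianRing R] (V : ValuationSubring L)
    (hV : ∀ r : R, algebraMap R L r ∈ V) (I : Ideal R) (n : ℕ) :
    ∀ a ∈ I ^ n, value V a * (idealWeight V I : V.ValueGroup) ^ n ≤ 1 := by
  have h1 : ∀ a ∈ I, value V a * (idealWeight V I : V.ValueGroup) ≤ 1 := by
    intro a ha
    have hle : value V a ≤ idealValue V I := (idealValue_isGreatest V hV I).2 ⟨a, ha, rfl⟩
    unfold idealWeight
    split_ifs with h
    · rw [h] at hle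
      simp [le_zero_iff.1 hle]
    · simpa using mul_inv_le_of_le_mul₀ zero_le zero_le (by simpa using hle)
  induction n with
  | zero => exact fun a _ => by simp [value, hV a]
  | succ n ih =>
    intro a ha
    rw [pow_succ] at ha
    refine Submodule.mul_induction_on ha (fun x hx y hy => ?_) (fun x y hx hy => ?_)
    · rw [pow_succ, show value V (x * y) = value V x * value V y by simp [value],
        mul_mul_mul_comm]
      exact mul_le_one' (ih x hx) (h1 y hy)
    · have : value V (x + y) ≤ max (value V x) (value V y) := by
        simp only [value, map_add]
        exact V.valuation.map_add (algebraMap R L x) (algebraMap R L y)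
      refine (mul_le_mul_left this _).trans ?_
      rcases max_choice (value V x) (value V y) with h | h <;> rw [h] <;> assumption

/-- `E ⊆ W`. -/
theorem reesToRatFunc_mem [IsNoetherianRing R] (V : ValuationSubring L)
    (hV : ∀ r : R, algebraMap R L r ∈ V) (I : Ideal R) (f : reesAlgebra I) :
    reesToRatFunc L I f ∈ reesExtension V I := by
  change reesValuation V I (algebraMap L[X] (RatFunc L) (map (algebraMap R L) (f : R[X]))) ≤ 1
  rw [reesValuation, gaussValuation_algebraMap]
  refine Finset.sup_le fun n _ => ?_
  rw [coeff_map]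
  exact value_mul_idealWeight_pow_le_one V hV I n _ (f.2 n)

/-- `P* = E ∩ M(W)`. -/
def reesCenter [IsNoetherianRing R] (I : Ideal R) (V : ValuationSubring L)
    (hV : ∀ r : R, algebraMap R L r ∈ V) : Ideal (reesAlgebra I) :=
  (IsLocalRing.maximalIdeal (reesExtension V I)).comap
    ((reesToRatFunc L I).codRestrict (reesExtension V I).toSubring (reesToRatFunc_mem V hV I))

/-- The prime ideal `P*_j` of the Rees ring belonging to a dicritical divisor `V_j` of `I`. -/
def dicriticalPrime [IsLocalRing R] [IsNoetherianRing R] {I : Ideal R}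
    (V : dicriticalDivisors L I) : Ideal (reesAlgebra I) :=
  reesCenter I V.1 (algebraMap_mem_of_mem_dicriticalDivisors V.2)

variable (L) in
/-- `Λ'`: the dicritical divisors `V_j` such that `P*_j` has depth `d`, i.e. `dim E/P*_j = d`. -/
def topDicriticals [IsLocalRing R] [IsNoetherianRing R] (I : Ideal R) (d : ℕ) :
    Set (dicriticalDivisors L I) :=
  {V | ringKrullDim (reesAlgebra I ⧸ dicriticalPrime V) = d}

/-- The element `x Z` of the Rees ring, for `x ∈ I`. -/
def reesDegreeOne {I : Ideal R} (x : I) : reesAlgebra I :=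
  ⟨monomial 1 (x : R), reesAlgebra.monomial_mem.2 (by simp)⟩

end Values

end Dicritical

end

/-!
Everything is read off the Rees ring `E = R[IZ]` and the charts `A = R[I x⁻¹]` of the blowup of
`I`.

*Dicritical divisors and primes of `E`.* Since all powers of `I` are complete, every chart is
normal (`isIntegrallyClosed_blowupChart`). Hence the one-dimensional members of the blowup which
dominate `R` are already discrete valuation rings, and the dicritical divisors are exactly the
localizations `A_Q` at the minimal primes `Q` of `x A` (`exists_isChart`,
`exists_isChart_of_mem_minimalPrimes`). For `f ∈ Iⁿ` the element `f Zⁿ` lies in the prime `P*` of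
`V = A_Q` if and only if `f / xⁿ ∈ Q` (`IsChart.chartElem_mem_iff`). Clearing denominators shows
that `P*` is minimal over `x E`, so it has height one and is minimal over `M E`; conversely a
minimal prime of `M E` avoids some `x Z` and comes from a minimal prime of `x A`
(`range_dicriticalPrime`). That `a ∈ Iⁿ` has the value of `Iⁿ` at `V` means that `a Zⁿ ∉ P*`
(`value_eq_idealValue_pow_iff`), so all statements about values become statements about avoiding
primes of `E`.

*Reductions.* By Nakayama's lemma elements of `Iⁿ` generate a reduction of `Iⁿ` as soon as the
ideal of `E` generated by `M` and the corresponding monomials contains a power of the irrelevant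
ideal (`isReduction_of_le_radical`). A minimal prime of a homogeneous ideal containing `M E` whose
residue ring has dimension zero contains the irrelevant ideal, so it suffices to find homogeneous
parameters (`exists_parameters`); they come from homogeneous prime avoidance in large degrees, and
from linear avoidance in degree one if the residue field is infinite. The number of parameters
needed is the maximum of `dim (E / P*)`, and one less if a first parameter avoiding the primes in
`Λ'` is given.

*Dimensions.* The ring `E` is generated by elements `y Z` of the quotient field of `R[y₁ Z]`,
whence `dim E ≤ d + 1` and `dim (E / P*) ≤ d`. If all these dimensions were less than `d`, a power
of `I` would have a reduction generated by `d - 1` elements, against Krull's height theorem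
(`nonempty_topDicriticals`). In the other direction, a reduction `(x₁, …, x_d)` of `I` makes
`E / P*` integral over the subring generated by `R` and the `xᵢ Z`, so that no `xᵢ Z` can lie in a
`P*` with `dim (E / P*) = d`. In dimension one `R` is the only dicritical divisor; in dimension
two a prime `P*` with `dim (E / P*) < 2` would give a point of a chart which is isolated in its
fibre, and Zariski's main theorem excludes it.
-/

noncomputable section

namespace Dicritical

/-! ### Krull dimension of quotients, integral extensions and birational extensions -/

section Dimension

theorem ringKrullDim_quotient_add_one_le_of_lt {A : Type*} [CommRing A] {P P' : Ideal A}
    [P.IsPrime] (h : P < P') : ringKrullDim (A ⧸ P') + 1 ≤ ringKrullDim (A ⧸ P) := by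
  obtain ⟨hle, r, hr', hr⟩ := SetLike.lt_iff_le_and_exists.1 h
  refine ringKrullDim_succ_le_of_surjective (Ideal.Quotient.factor hle)
    (Ideal.Quotient.factor_surjective hle) (r := Ideal.Quotient.mk P r) ?_ ?_
  · rw [mem_nonZeroDivisors_iff_ne_zero]
    exact fun h => hr (Ideal.Quotient.eq_zero_iff_mem.1 h)
  · simpa using Ideal.Quotient.eq_zero_iff_mem.2 hr'

theorem ringKrullDim_quotient_le_of_le {A : Type*} [CommRing A] {P P' : Ideal A}
    (h : P ≤ P') : ringKrullDim (A ⧸ P') ≤ ringKrullDim (A ⧸ P) :=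
  ringKrullDim_le_of_surjective _ (Ideal.Quotient.factor_surjective h)

theorem WithBot.le_of_add_one_le {a : WithBot ℕ∞} {n : ℕ} (h : a + 1 ≤ ((n + 1 : ℕ) : WithBot ℕ∞)) :
    a ≤ n := by
  induction a with
  | bot => exact bot_le
  | coe a =>
    induction a with
    | top =>
      have h2 : ((⊤ : ℕ∞) : WithBot ℕ∞) ≤ ((n + 1 : ℕ) : ℕ∞) := h
      exact absurd (top_le_iff.1 (WithBot.coe_le_coe.1 h2)) (ENat.natCast_ne_top _)
    | coe a =>
      have : ((a + 1 : ℕ) : WithBot ℕ∞) ≤ ((n + 1 : ℕ) : WithBot ℕ∞) := by exact_mod_cast h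
      have h2 : a + 1 ≤ n + 1 := by exact_mod_cast this
      exact_mod_cast Nat.le_of_succ_le_succ h2

theorem ringKrullDim_le_of_isIntegral {A B : Type*} [CommRing A] [CommRing B] (f : A →+* B)
    (hf : f.IsIntegral) : ringKrullDim B ≤ ringKrullDim A := by
  algebraize [f]
  have : Algebra.IsIntegral A B := ⟨hf⟩
  refine Order.krullDim_le_of_strictMono (PrimeSpectrum.comap f) fun P Q h => ?_
  exact Ideal.IsIntegral.comap_lt_comap (R := A) (I := P.asIdeal) (J := Q.asIdeal) h

/-- A Noetherian ring does not gain dimension when one adjoins an element satisfying a nontrivial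
polynomial relation. -/
theorem ringKrullDim_le_of_surjective_polynomial {A B : Type*} [CommRing A] [IsDomain A]
    [IsNoetherianRing A] [CommRing B] (f : A[X] →+* B) (hf : Function.Surjective f) {p : A[X]}
    (hp : p ≠ 0) (hfp : f p = 0) {n : ℕ} (hA : ringKrullDim A ≤ n) : ringKrullDim B ≤ n := by
  have h := ringKrullDim_succ_le_of_surjective f hf (mem_nonZeroDivisors_iff_ne_zero.2 hp) hfp
  rw [Polynomial.ringKrullDim_of_isNoetherianRing] at h
  refine WithBot.le_of_add_one_le (h.trans ?_)
  push_cast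
  gcongr

/-- If `a` is a quotient of elements of `R[s]`, then passing from `R[s]` to `R[s, a]` does not raise
the dimension. -/
theorem ringKrullDim_adjoin_insert_le {R E : Type*} [CommRing R] [IsNoetherianRing R] [CommRing E]
    [IsDomain E] [Algebra R E] (s : Set E) (hs : s.Finite) {n : ℕ}
    (hn : ringKrullDim (Algebra.adjoin R s) ≤ n) {a b c : E} (hb : b ∈ Algebra.adjoin R s)
    (hc : c ∈ Algebra.adjoin R s) (hb0 : b ≠ 0) (h : b * a = c) :
    ringKrullDim (Algebra.adjoin R (insert a s)) ≤ n := by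
  have hle : Algebra.adjoin R s ≤ Algebra.adjoin R (insert a s) :=
    Algebra.adjoin_mono (Set.subset_insert a s)
  have ha : a ∈ Algebra.adjoin R (insert a s) := Algebra.subset_adjoin (Set.mem_insert a s)
  have : IsNoetherianRing (Algebra.adjoin R s) :=
    isNoetherianRing_of_fg (Subalgebra.fg_def.2 ⟨s, hs, rfl⟩)
  let f : (Algebra.adjoin R s)[X] →+* Algebra.adjoin R (insert a s) :=
    eval₂RingHom (Subalgebra.inclusion hle).toRingHom ⟨a, ha⟩
  refine ringKrullDim_le_of_surjective_polynomial f ?_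
    (p := C ⟨b, hb⟩ * X - C ⟨c, hc⟩) ?_ ?_ hn
  · rintro ⟨z, hz⟩
    have hrange : Algebra.adjoin R (insert a s) ≤
        (((Algebra.adjoin R (insert a s)).val : _ →ₐ[R] E).comp
          ({ toRingHom := f, commutes' := fun r => by
              change f (C (algebraMap R _ r)) = _
              simp [f] } : (Algebra.adjoin R s)[X] →ₐ[R] _)).range := by
      refine Algebra.adjoin_le ?_
      rintro y (rfl | hy)
      · exact ⟨X, by simp [f]⟩
      · exact ⟨C ⟨y, Algebra.subset_adjoin hy⟩, by simp [f]⟩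
    obtain ⟨p, hp⟩ := hrange hz
    exact ⟨p, Subtype.ext hp⟩
  · intro h0
    have := congrArg (fun p => coeff p 1) h0
    simp [coeff_C] at this
    exact hb0 (congrArg Subtype.val this)
  · ext
    simp [f, h]

end Dimension

/-! ### Systems of parameters by prime avoidance -/

/-- Let every finite set of primes that contain `K₀` and do not contain `U` be avoided by an element
of `A`. If the minimal primes of `K ≥ K₀` not containing `U` have dimension at most `m`, then adding
`m` elements of `A` to `K` brings that dimension down to `0`. -/
theorem exists_parameters {E : Type*} [CommRing E] [IsNoetherianRing E] (K₀ : Ideal E) (U A : Set E)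
    (hA : ∀ 𝒮 : Set (Ideal E), 𝒮.Finite → (∀ P ∈ 𝒮, P.IsPrime ∧ K₀ ≤ P ∧ ¬ U ⊆ P) →
      ∃ a ∈ A, ∀ P ∈ 𝒮, a ∉ P) (m : ℕ) :
    ∀ K : Ideal E, K₀ ≤ K →
      (∀ P ∈ K.minimalPrimes, ¬ U ⊆ P → ringKrullDim (E ⧸ P) ≤ m) →
      ∃ a : Fin m → E, (∀ i, a i ∈ A) ∧
        ∀ P ∈ (K ⊔ Ideal.span (Set.range a)).minimalPrimes, ¬ U ⊆ P →
          ringKrullDim (E ⧸ P) ≤ 0 := by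
  induction m with
  | zero =>
    intro K _ hK
    refine ⟨Fin.elim0, fun i => i.elim0, fun P hP hU => ?_⟩
    rw [Set.range_eq_empty, Ideal.span_empty, sup_bot_eq] at hP
    exact hK P hP hU
  | succ m ih =>
    intro K hK₀ hK
    obtain ⟨a, haA, ha⟩ := hA {P | P ∈ K.minimalPrimes ∧ ¬ U ⊆ P}
      (K.finite_minimalPrimes_of_isNoetherianRing.subset fun P hP => hP.1)
      fun P hP => ⟨hP.1.1.1, hK₀.trans hP.1.1.2, hP.2⟩
    obtain ⟨b, hbA, hb⟩ := ih (K ⊔ Ideal.span {a}) (hK₀.trans le_sup_left) (by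
      intro P' hP' hU
      have := hP'.1.1
      obtain ⟨P, hP, hPP'⟩ := Ideal.exists_minimalPrimes_le (le_sup_left.trans hP'.1.2)
      have := hP.1.1
      have hPU : ¬ U ⊆ P := fun h => hU (h.trans hPP')
      have hlt : P < P' := lt_of_le_of_ne hPP' fun h => ha P ⟨hP, hPU⟩ (h ▸
        hP'.1.2 (Ideal.mem_sup_right (Ideal.mem_span_singleton_self a)))
      exact WithBot.le_of_add_one_le
        ((ringKrullDim_quotient_add_one_le_of_lt hlt).trans (hK P hP hPU)))
    refine ⟨Fin.cons a b, Fin.cases haA hbA, ?_⟩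
    rwa [Fin.range_cons, Ideal.span_insert, ← sup_assoc]

/-! ### The grading of the Rees ring -/

section Grading

variable {R : Type u} [CommRing R] {I : Ideal R}

/-- The element `a Zⁿ` of the Rees ring, for `a ∈ Iⁿ`. -/
def reesMonomial {n : ℕ} {a : R} (ha : a ∈ I ^ n) : reesAlgebra I :=
  ⟨monomial n a, reesAlgebra.monomial_mem.2 ha⟩

theorem reesMonomial_congr {n m : ℕ} {a b : R} {ha : a ∈ I ^ n} {hb : b ∈ I ^ m} (hn : n = m)
    (h : a = b) : reesMonomial ha = reesMonomial hb := by
  subst hn h; rfl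

theorem mul_mem_ideal_pow {n m : ℕ} {a b : R} (ha : a ∈ I ^ n) (hb : b ∈ I ^ m) :
    a * b ∈ I ^ (n + m) :=
  pow_add I n m ▸ Ideal.mul_mem_mul ha hb

theorem reesMonomial_mul {n m : ℕ} {a b : R} (ha : a ∈ I ^ n) (hb : b ∈ I ^ m) :
    reesMonomial ha * reesMonomial hb = reesMonomial (mul_mem_ideal_pow ha hb) :=
  Subtype.ext (monomial_mul_monomial n m a b)

theorem pow_mem_ideal_pow {n : ℕ} {a : R} (ha : a ∈ I ^ n) (k : ℕ) : a ^ k ∈ I ^ (n * k) :=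
  pow_mul I n k ▸ Ideal.pow_mem_pow ha k

theorem reesMonomial_pow {n : ℕ} {a : R} (ha : a ∈ I ^ n) (k : ℕ) :
    reesMonomial ha ^ k = reesMonomial (pow_mem_ideal_pow ha k) :=
  Subtype.ext (monomial_pow n a k)

theorem reesMonomial_add {n : ℕ} {a b : R} (ha : a ∈ I ^ n) (hb : b ∈ I ^ n) :
    reesMonomial ha + reesMonomial hb = reesMonomial (add_mem ha hb) :=
  Subtype.ext (monomial n |>.map_add a b).symm

theorem reesDegreeOne_eq (x : I) :
    reesDegreeOne x = reesMonomial (n := 1) ((pow_one I).symm ▸ x.2 : (x : R) ∈ I ^ 1) := rfl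

variable (I) in
/-- The `R`-linear map `x ↦ x Z` from `I` to the Rees ring. -/
def reesDegreeOneLinear : I →ₗ[R] reesAlgebra I where
  toFun := reesDegreeOne
  map_add' x y := Subtype.ext ((monomial 1).map_add (x : R) y)
  map_smul' r x := Subtype.ext (smul_monomial r 1 (x : R)).symm

theorem smul_reesMonomial {n : ℕ} {a : R} (r : R) (ha : a ∈ I ^ n) :
    r • reesMonomial ha = reesMonomial (Ideal.mul_mem_left _ r ha) :=
  Subtype.ext (smul_monomial r n a)

theorem sum_reesMonomial (f : reesAlgebra I) :
    ∑ i ∈ (f : R[X]).support, reesMonomial (f.2 i) = f := by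
  refine Subtype.ext ?_
  rw [AddSubmonoidClass.coe_finsetSum]
  exact (f : R[X]).as_sum_support.symm

variable (I) in
/-- The homogeneous elements of degree `n` of the Rees ring: the elements `a Zⁿ` with `a ∈ Iⁿ`. -/
def reesGrading (n : ℕ) : Submodule R (reesAlgebra I) where
  carrier := {f | ∀ i, i ≠ n → (f : R[X]).coeff i = 0}
  add_mem' hf hg i hi := by simp [hf i hi, hg i hi]
  zero_mem' i _ := by simp
  smul_mem' r f hf i hi := by simp [hf i hi]

theorem reesMonomial_mem_reesGrading {n : ℕ} {a : R} (ha : a ∈ I ^ n) :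
    reesMonomial ha ∈ reesGrading I n := fun i hi => by
  simp [reesMonomial, coeff_monomial, hi.symm]

theorem eq_reesMonomial_of_mem {n : ℕ} {f : reesAlgebra I} (hf : f ∈ reesGrading I n) :
    f = reesMonomial (f.2 n) := by
  refine Subtype.ext (Polynomial.ext fun i => ?_)
  rcases eq_or_ne i n with rfl | h
  · simp [reesMonomial]
  · simp [reesMonomial, coeff_monomial, h.symm, hf i h]

instance : SetLike.GradedMonoid (reesGrading I) where
  one_mem := fun i hi => by simp [coeff_one, hi]
  mul_mem i j f g hf hg := by
    rw [eq_reesMonomial_of_mem hf, eq_reesMonomial_of_mem hg, reesMonomial_mul]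
    exact reesMonomial_mem_reesGrading _

theorem coeff_coeAddMonoidHom (x : DirectSum ℕ fun n => reesGrading I n) (i : ℕ) :
    ((DirectSum.coeAddMonoidHom (reesGrading I) x : reesAlgebra I) : R[X]).coeff i =
      ((x i : reesAlgebra I) : R[X]).coeff i := by
  classical
  induction x using DirectSum.induction_on with
  | zero => simp
  | of j f =>
    rw [DirectSum.coeAddMonoidHom_of]
    rcases eq_or_ne j i with rfl | h
    · rw [DirectSum.of_eq_same]
    · rw [DirectSum.of_eq_of_ne _ _ _ h.symm, f.2 i h.symm]
      simp
  | add x y hx hy => simp [hx, hy]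

instance : DirectSum.Decomposition (reesGrading I) :=
  DirectSum.IsInternal.chooseDecomposition _ <| by
    classical
    refine ⟨fun x y h => ?_, fun f => ?_⟩
    · refine DFinsupp.ext fun i => ?_
      have hi := congrArg (fun f : reesAlgebra I => (f : R[X]).coeff i) h
      simp only [coeff_coeAddMonoidHom] at hi
      refine Subtype.ext ?_
      rw [eq_reesMonomial_of_mem (x i).2, eq_reesMonomial_of_mem (y i).2]
      exact reesMonomial_congr rfl hi
    · refine ⟨∑ i ∈ (f : R[X]).support,
        DirectSum.of (fun n => reesGrading I n) i ⟨_, reesMonomial_mem_reesGrading (f.2 i)⟩, ?_⟩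
      simp only [map_sum, DirectSum.coeAddMonoidHom_of]
      exact sum_reesMonomial f

instance : GradedRing (reesGrading I) where

theorem coe_decompose (f : reesAlgebra I) (i : ℕ) :
    (DirectSum.decompose (reesGrading I) f i : reesAlgebra I) = reesMonomial (f.2 i) := by
  rw [eq_reesMonomial_of_mem (DirectSum.decompose (reesGrading I) f i).2]
  refine reesMonomial_congr rfl ?_
  rw [← coeff_coeAddMonoidHom]
  exact congrArg (fun f : reesAlgebra I => (f : R[X]).coeff i)
    ((DirectSum.decompose (reesGrading I)).left_inv f)

/-- A minimal prime of a homogeneous ideal is homogeneous, so if it is also a maximal ideal it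
cannot miss any `y Z`: an inverse of `y Z` modulo it would put its degree zero component `1` into
it. -/
theorem reesDegreeOne_mem_of_ringKrullDim_le_zero {K P : Ideal (reesAlgebra I)}
    (hK : K.IsHomogeneous (reesGrading I)) (hP : P ∈ K.minimalPrimes)
    (h0 : ringKrullDim (reesAlgebra I ⧸ P) ≤ 0) (y : I) : reesDegreeOne y ∈ P := by
  have hPp : P.IsPrime := hP.1.1
  have hPhom : P.IsHomogeneous (reesGrading I) := by
    have hcore : P ≤ (P.homogeneousCore (reesGrading I)).toIdeal := by
      refine hP.2 ⟨hPp.homogeneousCore, ?_⟩ (P.toIdeal_homogeneousCore_le _)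
      rw [← hK.toIdeal_homogeneousCore_eq_self]
      exact Ideal.homogeneousCore_mono _ hP.1.2
    rw [le_antisymm hcore (P.toIdeal_homogeneousCore_le _)]
    exact HomogeneousIdeal.isHomogeneous _
  obtain ⟨m, hm, hPm⟩ := P.exists_le_maximal hPp.ne_top
  have hPmax : P = m := by
    by_contra hne
    have h1 := (ringKrullDim_quotient_add_one_le_of_lt (lt_of_le_of_ne hPm hne)).trans h0
    have : Nontrivial (reesAlgebra I ⧸ m) := Ideal.Quotient.nontrivial_iff.2 hm.ne_top
    have h2 : (0 : WithBot ℕ∞) ≤ ringKrullDim (reesAlgebra I ⧸ m) :=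
      ringKrullDim_nonneg_of_nontrivial
    have h3 : (0 : WithBot ℕ∞) + 1 ≤ 0 := le_trans (by gcongr) h1
    exact absurd h3 (by decide)
  by_contra hy
  obtain ⟨g, i, hi, hg⟩ := (hPmax ▸ hm).exists_inv hy
  have h1 : (i : R[X]).coeff 0 = 1 := by
    have := congrArg (fun f : reesAlgebra I => (f : R[X]).coeff 0) hg
    simpa [reesDegreeOne, mul_coeff_zero] using this
  have h2 := hPhom 0 hi
  rw [coe_decompose] at h2
  refine hPp.ne_top ((Ideal.eq_top_iff_one _).2 ?_)
  convert h2 using 1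
  refine Subtype.ext ?_
  simp [reesMonomial, h1]

end Grading

/-! ### Avoiding primes by homogeneous elements -/

section Avoidance

variable {R : Type u} [CommRing R] {I : Ideal R}

/-- Homogeneous prime avoidance in the Rees ring: finitely many primes, none of which contains all
elements `y Z`, are avoided by one homogeneous element of positive degree. -/
theorem exists_reesMonomial_notMem (N : ℕ) : ∀ s : Finset (Ideal (reesAlgebra I)), s.card ≤ N →
    (∀ P ∈ s, P.IsPrime ∧ ∃ y : I, reesDegreeOne y ∉ P) →
    ∃ n, 1 ≤ n ∧ ∃ (a : R) (ha : a ∈ I ^ n), ∀ P ∈ s, reesMonomial ha ∉ P := by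
  classical
  induction N with
  | zero =>
    intro s hs _
    rw [Nat.le_zero, Finset.card_eq_zero] at hs
    exact ⟨1, le_rfl, 0, zero_mem _, by simp [hs]⟩
  | succ N ih =>
    intro s hsN hs
    rcases s.eq_empty_or_nonempty with rfl | ⟨P₀, hP₀⟩
    · exact ⟨1, le_rfl, 0, zero_mem _, by simp⟩
    set t := s.erase P₀ with ht
    have hcard : t.card + 1 = s.card := Finset.card_erase_add_one hP₀
    have hts : ∀ P ∈ t, P ∈ s := fun P hP => Finset.mem_of_mem_erase hP
    have hst : ∀ P ∈ s, P = P₀ ∨ P ∈ t := fun P hP => by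
      rw [ht, Finset.mem_erase]; tauto
    by_cases hdom : ∃ P ∈ t, ∀ (m : ℕ) (b : R) (hb : b ∈ I ^ m),
        reesMonomial hb ∈ P → reesMonomial hb ∈ P₀
    · -- The homogeneous part of `P` lies in `P₀`, so a homogeneous element avoiding `P₀` avoids `P`.
      obtain ⟨P, hPt, hP⟩ := hdom
      obtain ⟨n, hn, a, ha, h⟩ := ih (insert P₀ (t.erase P))
        (by
          have := Finset.card_insert_le P₀ (t.erase P)
          have := Finset.card_erase_add_one hPt
          omega)
        (by
          intro Q hQ
          rcases Finset.mem_insert.1 hQ with rfl | hQ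
          · exact hs _ hP₀
          · exact hs _ (hts _ (Finset.mem_of_mem_erase hQ)))
      have h0 := h P₀ (Finset.mem_insert_self _ _)
      refine ⟨n, hn, a, ha, fun Q hQ => ?_⟩
      rcases hst Q hQ with rfl | hQt
      · exact h0
      · by_cases hQP : Q = P
        · exact hQP ▸ fun h' => h0 (hP n a ha h')
        · exact h Q (Finset.mem_insert_of_mem (Finset.mem_erase.2 ⟨hQP, hQt⟩))
    · push Not at hdom
      have hP₀p := (hs P₀ hP₀).1
      obtain ⟨n, hn, a, ha, h⟩ := ih t (by omega) fun P hP => hs P (hts P hP)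
      -- A homogeneous element of positive degree in all members of `t` but not in `P₀`.
      have hprod : ∀ t' ⊆ t, ∃ m, 1 ≤ m ∧ ∃ (b : R) (hb : b ∈ I ^ m),
          reesMonomial hb ∉ P₀ ∧ ∀ P ∈ t', reesMonomial hb ∈ P := by
        intro t'
        induction t' using Finset.induction_on with
        | empty =>
          intro _
          obtain ⟨y, hy⟩ := (hs P₀ hP₀).2
          exact ⟨1, le_rfl, y, (pow_one I).symm ▸ y.2, hy, by simp⟩
        | insert P t' hPt' iht =>
          intro hsub
          obtain ⟨m, hm, b, hb, hb0, hbt⟩ :=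
            iht ((Finset.subset_insert _ _).trans hsub)
          obtain ⟨k, c, hc, hcP, hc0⟩ := hdom P (hsub (Finset.mem_insert_self _ _))
          refine ⟨m + k, by omega, b * c, mul_mem_ideal_pow hb hc, ?_, ?_⟩
          · rw [← reesMonomial_mul hb hc]
            exact fun h => (hP₀p.mem_or_mem h).elim hb0 hc0
          · intro Q hQ
            rw [← reesMonomial_mul hb hc]
            rcases Finset.mem_insert.1 hQ with rfl | hQ
            · exact Ideal.mul_mem_left _ _ hcP
            · exact Ideal.mul_mem_right _ _ (hbt Q hQ)
      obtain ⟨m, hm, b, hb, hb0, hbt⟩ := hprod t subset_rfl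
      by_cases ha0 : reesMonomial ha ∈ P₀
      · -- `aᵐ + bⁿ` is homogeneous of degree `n m`.
        have hb' : b ^ n ∈ I ^ (n * m) := mul_comm m n ▸ pow_mem_ideal_pow hb n
        have hbe : reesMonomial hb' = reesMonomial hb ^ n := by
          rw [reesMonomial_pow]; exact reesMonomial_congr (mul_comm _ _) rfl
        refine ⟨n * m, Nat.mul_pos hn hm, a ^ m + b ^ n,
          add_mem (pow_mem_ideal_pow ha m) hb', fun P hP hmem => ?_⟩
        rw [← reesMonomial_add (pow_mem_ideal_pow ha m) hb', ← reesMonomial_pow ha, hbe] at hmem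
        rcases hst P hP with rfl | hPt
        · exact hb0 (hP₀p.mem_of_pow_mem n
            ((Ideal.add_mem_iff_right _ (Ideal.pow_mem_of_mem _ ha0 m hm)).1 hmem))
        · exact h P hPt ((hs P hP).1.mem_of_pow_mem m
            ((Ideal.add_mem_iff_left _ (Ideal.pow_mem_of_mem _ (hbt P hPt) n hn)).1 hmem))
      · refine ⟨n, hn, a, ha, fun P hP => ?_⟩
        rcases hst P hP with rfl | hPt
        · exact ha0
        · exact h P hPt

/-- Linear avoidance: over an infinite residue field, one `x Z` avoids finitely many ideals
containing `M E`, none of which contains all `y Z`. -/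
theorem exists_reesDegreeOne_notMem [IsLocalRing R] [Infinite (IsLocalRing.ResidueField R)]
    (s : Finset (Ideal (reesAlgebra I)))
    (hs : ∀ P ∈ s, (IsLocalRing.maximalIdeal R).map (algebraMap R (reesAlgebra I)) ≤ P ∧
      ∃ y : I, reesDegreeOne y ∉ P) : ∃ x : I, ∀ P ∈ s, reesDegreeOne x ∉ P := by
  let p (P : Ideal (reesAlgebra I)) : Submodule R I :=
    (P.restrictScalars R).comap (reesDegreeOneLinear I)
  by_contra! hcon
  have hcover : ⋃ P ∈ s, (p P : Set I) = Set.univ := by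
    refine Set.eq_univ_of_forall fun x => ?_
    obtain ⟨P, hP, hx⟩ := hcon x
    exact Set.mem_biUnion hP hx
  obtain ⟨P, hP, hfi⟩ := Submodule.exists_finiteIndex_of_cover hcover
  have : Finite (I ⧸ p P) := AddSubgroup.finite_quotient_of_finiteIndex
  obtain ⟨hM, y, hy⟩ := hs P hP
  -- The map `r ↦ r y` embeds the residue field into the finite quotient.
  let f : R →ₗ[R] I ⧸ p P := (p P).mkQ.comp (LinearMap.toSpanSingleton R I y)
  have hmemf : ∀ r, r ∈ LinearMap.ker f ↔ r • reesDegreeOne y ∈ P := fun r => by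
    change Submodule.Quotient.mk (r • y) = (0 : I ⧸ p P) ↔ _
    rw [Submodule.Quotient.mk_eq_zero]
    change reesDegreeOneLinear I (r • y) ∈ P ↔ _
    rw [map_smul]
    rfl
  have hker : LinearMap.ker f = IsLocalRing.maximalIdeal R := by
    refine le_antisymm (IsLocalRing.le_maximalIdeal fun htop => hy ?_) fun r hr => ?_
    · have h1 : (1 : R) ∈ LinearMap.ker f := htop ▸ Submodule.mem_top
      simpa using (hmemf 1).1 h1
    · rw [hmemf, Algebra.smul_def]
      exact P.mul_mem_right _ (hM (Ideal.mem_map_of_mem _ hr))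
  have hfin : Finite (R ⧸ LinearMap.ker f) :=
    Finite.of_injective _ (LinearMap.ker_eq_bot.1 (Submodule.ker_liftQ_eq_bot _ f le_rfl le_rfl))
  have hsurj : Function.Surjective (Submodule.factor hker.le) := Submodule.factor_surjective hker.le
  have : Finite (R ⧸ IsLocalRing.maximalIdeal R) := Finite.of_surjective _ hsurj
  have : Infinite (R ⧸ IsLocalRing.maximalIdeal R) := ‹Infinite (IsLocalRing.ResidueField R)›
  exact _root_.not_finite (R ⧸ IsLocalRing.maximalIdeal R)

end Avoidance

/-! ### Reductions and the fibre of the Rees ring -/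

section Reductions

variable {R : Type u} [CommRing R] {I : Ideal R}

theorem reesMonomial_mem_pow_span (n : ℕ) {a : R} (ha : a ∈ I ^ n) :
    reesMonomial ha ∈ Ideal.span (Set.range (reesDegreeOne (I := I))) ^ n := by
  induction n generalizing a with
  | zero => simp
  | succ n ih =>
    have hle : I ^ n * I ≤ I ^ (n + 1) := (pow_succ I n).ge
    suffices h : ∃ h : a ∈ I ^ (n + 1),
        reesMonomial h ∈ Ideal.span (Set.range (reesDegreeOne (I := I))) ^ (n + 1) from h.2
    rw [pow_succ] at ha
    refine Submodule.mul_induction_on ha (fun b hb c hc => ⟨hle (Ideal.mul_mem_mul hb hc), ?_⟩) ?_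
    · have hc' : c ∈ I ^ 1 := (pow_one I).symm ▸ hc
      have hcs : reesMonomial hc' ∈ Ideal.span (Set.range (reesDegreeOne (I := I))) :=
        Ideal.subset_span ⟨⟨c, hc⟩, rfl⟩
      have := Ideal.mul_mem_mul (ih hb) hcs
      rwa [← pow_succ, reesMonomial_mul] at this
    · rintro b c ⟨hb, hb'⟩ ⟨hc, hc'⟩
      exact ⟨add_mem hb hc, reesMonomial_add hb hc ▸ add_mem hb' hc'⟩

/-- If a power of every `y Z` lies in the ideal generated by `M` and the `a Zⁿ`, `a ∈ S`, then `S`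
generates a reduction of `Iⁿ`. This is Nakayama's lemma in a large degree of the Rees ring. -/
theorem isReduction_of_le_radical [IsLocalRing R] [IsNoetherianRing R] {n : ℕ} (hn : 1 ≤ n)
    {S : Set R} (hS : S ⊆ (I ^ n : Ideal R)) {K : Ideal (reesAlgebra I)}
    (hK : K ≤ (IsLocalRing.maximalIdeal R).map (algebraMap R (reesAlgebra I)) ⊔
      Ideal.span {f | ∃ (a : R) (_ : a ∈ S) (ha : a ∈ I ^ n), f = reesMonomial ha})
    (h : ∀ y : I, reesDegreeOne y ∈ K.radical) : IsReduction (Ideal.span S) (I ^ n) := by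
  set M := IsLocalRing.maximalIdeal R
  have hJ : Ideal.span S ≤ I ^ n := Ideal.span_le.2 hS
  obtain ⟨N, hN⟩ := Ideal.exists_pow_le_of_le_radical_of_fg
    (Ideal.span_le.2 (Set.range_subset_iff.2 h))
    ((isNoetherianRing_iff_ideal_fg _).1 inferInstance
      (Ideal.span (Set.range (reesDegreeOne (I := I)))))
  refine ⟨hJ, N, ?_⟩
  have hcoeff : ∀ f ∈ K, ∀ m, n ≤ m → (f : R[X]).coeff m ∈
      M * I ^ m ⊔ Ideal.span S * I ^ (m - n) := by
    intro f hf
    have key : ∀ f ∈ Ideal.span ((algebraMap R (reesAlgebra I) '' (M : Set R)) ∪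
        {f | ∃ (a : R) (_ : a ∈ S) (ha : a ∈ I ^ n), f = reesMonomial ha}),
        ∀ (g : reesAlgebra I) (m : ℕ), n ≤ m →
        ((g * f : reesAlgebra I) : R[X]).coeff m ∈ M * I ^ m ⊔ Ideal.span S * I ^ (m - n) := by
      intro f hf
      induction hf using Submodule.span_induction with
      | mem f hf =>
        intro g m hm
        rcases hf with ⟨r, hr, rfl⟩ | ⟨a, haS, ha, rfl⟩
        · have : ((g * algebraMap R (reesAlgebra I) r : reesAlgebra I) : R[X]).coeff m =
              r * (g : R[X]).coeff m := by
            rw [mul_comm, ← Algebra.smul_def]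
            simp
          rw [this]
          exact Ideal.mem_sup_left (Ideal.mul_mem_mul hr (g.2 m))
        · have : ((g * reesMonomial ha : reesAlgebra I) : R[X]).coeff m =
              a * (g : R[X]).coeff (m - n) := by
            change ((g : R[X]) * monomial n a).coeff m = _
            conv_lhs => rw [← Nat.sub_add_cancel hm]
            rw [coeff_mul_monomial, mul_comm]
          rw [this]
          exact Ideal.mem_sup_right (Ideal.mul_mem_mul (Ideal.subset_span haS) (g.2 _))
      | zero => simp
      | add f f' _ _ hf hf' =>
        intro g m hm
        have := add_mem (hf g m hm) (hf' g m hm)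
        rw [← coeff_add] at this
        rwa [mul_add]
      | smul c f _ hf =>
        intro g m hm
        have := hf (g * c) m hm
        rwa [mul_assoc] at this
    intro m hm
    have := key f (by
      have := hK hf
      rwa [Ideal.map, ← Ideal.span_union] at this) 1 m hm
    rwa [one_mul] at this
  have hnak : I ^ (n * (N + 1)) ≤ Ideal.span S * I ^ (n * N) := by
    refine Submodule.le_of_le_smul_of_le_jacobson_bot (I := M)
      ((isNoetherianRing_iff_ideal_fg R).1 inferInstance _)
      (IsLocalRing.maximalIdeal_le_jacobson ⊥) fun a ha => ?_
    have h1 : reesMonomial ha ∈ K := hN (Ideal.pow_le_pow_right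
      (le_trans (Nat.le_succ N) (Nat.le_mul_of_pos_left _ hn)) (reesMonomial_mem_pow_span _ ha))
    have h2 := hcoeff _ h1 (n * (N + 1)) (Nat.le_mul_of_pos_right _ N.succ_pos)
    rw [show n * (N + 1) - n = n * N by rw [Nat.mul_succ, Nat.add_sub_cancel], sup_comm] at h2
    simpa [reesMonomial] using h2
  rw [← pow_mul, ← pow_mul]
  refine le_antisymm ?_ hnak
  rw [Nat.mul_succ, add_comm, pow_add]
  exact Ideal.mul_mono_left hJ

/-- If `J` is a reduction of `I`, then every `y Z` is integral over `R[J Z]`: multiplication by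
`y Z` preserves the finite `R[J Z]`-module generated by `Iⁿ Zⁿ` once `J Iⁿ = Iⁿ⁺¹`. -/
theorem isIntegral_reesDegreeOne [IsDomain R] [IsNoetherianRing R] (hI0 : I ≠ ⊥) {ι : Type*}
    (x : ι → I) (hx : IsReduction (Ideal.span (Set.range fun i => (x i : R))) I) (y : I) :
    IsIntegral (Algebra.adjoin R (Set.range fun i => reesDegreeOne (x i))) (reesDegreeOne y) := by
  obtain ⟨_, n, hn⟩ := hx
  set S := Algebra.adjoin R (Set.range fun i => reesDegreeOne (x i)) with hS
  let l : ↥(I ^ n) →ₗ[R] reesAlgebra I :=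
    { toFun := fun a => reesMonomial a.2
      map_add' := fun a b => (reesMonomial_add a.2 b.2).symm
      map_smul' := fun r a => (smul_reesMonomial r a.2).symm }
  let N : Submodule S (reesAlgebra I) := Submodule.span S (Set.range l)
  have hmem : ∀ {a : R} (ha : a ∈ I ^ n), reesMonomial ha ∈ N := fun ha =>
    Submodule.subset_span ⟨⟨_, ha⟩, rfl⟩
  have hfg : N.FG := by
    obtain ⟨T, hT⟩ : (⊤ : Submodule R ↥(I ^ n)).FG := Module.Finite.fg_top
    refine Submodule.fg_def.2 ⟨l '' T, T.finite_toSet.image l, le_antisymm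
      (Submodule.span_mono (Set.image_subset_range _ _)) (Submodule.span_le.2 ?_)⟩
    rintro _ ⟨a, rfl⟩
    refine Submodule.span_le_restrictScalars R S _ ?_
    rw [Submodule.span_image, hT]
    exact ⟨a, trivial, rfl⟩
  have hne : N ≠ ⊥ := by
    obtain ⟨a, ha, ha0⟩ := Submodule.exists_mem_ne_zero_of_ne_bot (pow_ne_zero n hI0 : I ^ n ≠ ⊥)
    intro h
    have := hmem ha
    rw [h, Submodule.mem_bot] at this
    have := congrArg (fun f : reesAlgebra I => (f : R[X]).coeff n) this
    exact ha0 (by simpa [reesMonomial] using this)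
  have hstep : ∀ b, b ∈ I ^ (n + 1) → ∃ hb : b ∈ I ^ (1 + n), reesMonomial hb ∈ N := by
    intro b hb
    rw [← hn] at hb
    have hle : ∀ {r s : R}, r ∈ I → s ∈ I ^ n → r * s ∈ I ^ (1 + n) := fun hr hs => by
      rw [pow_add, pow_one]; exact Ideal.mul_mem_mul hr hs
    have hadd : ∀ b c : R, (∃ hb : b ∈ I ^ (1 + n), reesMonomial hb ∈ N) →
        (∃ hb : c ∈ I ^ (1 + n), reesMonomial hb ∈ N) →
        ∃ hb : b + c ∈ I ^ (1 + n), reesMonomial hb ∈ N := by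
      rintro b c ⟨h, h'⟩ ⟨g, g'⟩
      exact ⟨add_mem h g, reesMonomial_add h g ▸ add_mem h' g'⟩
    refine Submodule.mul_induction_on hb (fun r hr s hs => ?_) hadd
    induction hr using Submodule.span_induction with
    | mem r hr =>
      obtain ⟨i, rfl⟩ := hr
      refine ⟨hle (x i).2 hs, ?_⟩
      have hxi : reesDegreeOne (x i) ∈ S := Algebra.subset_adjoin ⟨i, rfl⟩
      have h : reesDegreeOne (x i) * reesMonomial hs ∈ N := N.smul_mem ⟨_, hxi⟩ (hmem hs)
      rwa [reesDegreeOne_eq, reesMonomial_mul] at h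
    | zero =>
      refine ⟨by simp, ?_⟩
      convert N.zero_mem
      exact Subtype.ext (by simp [reesMonomial])
    | add r r' _ _ h h' => rw [add_mul]; exact hadd _ _ h h'
    | smul c r _ h =>
      obtain ⟨h, h'⟩ := h
      have h2 := N.smul_mem (algebraMap R S c) h'
      rw [algebraMap_smul, smul_reesMonomial] at h2
      rw [smul_eq_mul, mul_assoc]
      exact ⟨_, h2⟩
  refine isIntegral_of_smul_mem_submodule N hne hfg _ fun f hf => ?_
  induction hf using Submodule.span_induction with
  | mem f hf =>
    obtain ⟨a, rfl⟩ := hf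
    change reesDegreeOne y * reesMonomial a.2 ∈ N
    rw [reesDegreeOne_eq, reesMonomial_mul]
    exact (hstep _ (by rw [add_comm n 1, pow_add, pow_one]; exact Ideal.mul_mem_mul y.2 a.2)).2
  | zero => simp
  | add f g _ _ hf hg => rw [smul_add]; exact N.add_mem hf hg
  | smul c f _ hf => rw [smul_comm]; exact N.smul_mem c hf

end Reductions

/-! ### One-dimensional normal local subrings of a field -/

section LocalSubrings

theorem isDiscreteValuationRing_of_ringKrullDim_eq_one (A : Type*) [CommRing A] [IsDomain A]
    [IsLocalRing A] [IsNoetherianRing A] [IsIntegrallyClosed A] (h : ringKrullDim A = 1) :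
    IsDiscreteValuationRing A := by
  have : Ring.DimensionLEOne A := ⟨fun {p} hp hp' =>
    Ring.krullDimLE_one_iff_of_noZeroDivisors.1 (Ring.krullDimLE_iff.2 (by simp [h])) p hp hp'⟩
  have : IsDedekindDomain A := { }
  refine ((IsDiscreteValuationRing.TFAE A fun hA => ?_).out 0 2).2 this
  rw [ringKrullDim_eq_zero_of_isField hA] at h
  exact zero_ne_one h

variable {L : Type v} [Field L]

theorem exists_toLocalSubring_eq (S : LocalSubring L) [ValuationRing S.toSubring]
    [IsFractionRing S.toSubring L] : ∃ V : ValuationSubring L, V.toLocalSubring = S := by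
  refine ⟨⟨S.toSubring, fun x => ?_⟩, rfl⟩
  rcases ValuationRing.isInteger_or_isInteger S.toSubring x with ⟨y, hy⟩ | ⟨y, hy⟩
  · exact Or.inl (hy ▸ y.2)
  · exact Or.inr (hy ▸ y.2)

/-- A valuation ring is its own normalization and is maximal for domination. -/
theorem normalizationSet_toLocalSubring (V : ValuationSubring L) :
    normalizationSet V.toLocalSubring = {V.toLocalSubring} := by
  refine Set.eq_singleton_iff_unique_mem.2 ⟨?_, fun T hT =>
    (V.isMax_toLocalSubring.eq_of_le hT.2).symm⟩
  set S := V.toLocalSubring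
  let B := integralClosure S.toSubring L
  obtain ⟨Q, hQ, e⟩ := Ideal.exists_ideal_over_maximal_of_isIntegral
    (S := B) (IsLocalRing.maximalIdeal S.toSubring) (IsLocalRing.le_maximalIdeal (by simp))
  have hprime : (show Ideal B.toSubring from Q).IsPrime := hQ.isPrime
  have hle : S ≤ LocalSubring.ofPrime B.toSubring Q := by
    have hSB : S.toSubring ≤ B.toSubring := fun r hr => algebraMap_mem B ⟨r, hr⟩
    refine ⟨hSB.trans (LocalSubring.le_ofPrime _ _),
      ((IsLocalRing.local_hom_TFAE _).out 2 0).mp ?_⟩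
    conv_rhs => rw [← IsLocalization.AtPrime.map_eq_maximalIdeal (show Ideal B.toSubring from Q)]
    refine .trans ?_ (Ideal.map_mono <| Ideal.map_le_iff_le_comap.mpr e.ge)
    rw [Ideal.map_map]; rfl
  have heq : S = LocalSubring.ofPrime B.toSubring Q := V.isMax_toLocalSubring.eq_of_le hle
  exact ⟨⟨Q, hprime, heq⟩, le_rfl⟩

theorem mem_ofPrime (A : Subring L) (Q : Ideal A) [Q.IsPrime] {z : L} :
    z ∈ (LocalSubring.ofPrime A Q).toSubring ↔ ∃ a b : A, b ∉ Q ∧ z = a / b := by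
  constructor
  · intro hz
    obtain ⟨a, s, h⟩ := IsLocalization.exists_mk'_eq Q.primeCompl
      (⟨z, hz⟩ : (LocalSubring.ofPrime A Q).toSubring)
    rw [IsLocalization.mk'_eq_iff_eq_mul] at h
    have hs0 : (s : A) ≠ 0 := fun h0 => s.2 (h0 ▸ Q.zero_mem)
    have h' : (a : L) = z * (s : A) := congrArg Subtype.val h
    exact ⟨a, s, s.2, (eq_div_iff (by simpa using hs0)).2 h'.symm⟩
  · rintro ⟨a, b, hb, rfl⟩
    have hb0 : (b : L) ≠ 0 := fun h0 => hb ((Subtype.ext h0 : b = 0) ▸ Q.zero_mem)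
    obtain ⟨c, hc⟩ := IsLocalization.map_units (LocalSubring.ofPrime A Q).toSubring
      (⟨b, hb⟩ : Q.primeCompl)
    have h1 : ((c⁻¹ : (LocalSubring.ofPrime A Q).toSubringˣ) :
        (LocalSubring.ofPrime A Q).toSubring).1 * b = 1 := by
      have h2 : (c⁻¹ : (LocalSubring.ofPrime A Q).toSubringˣ) *
        (c : (LocalSubring.ofPrime A Q).toSubring) = 1 := c.inv_mul
      rw [hc] at h2
      exact congrArg Subtype.val h2
    rw [div_eq_mul_inv, ← eq_inv_of_mul_eq_one_left h1]
    exact mul_mem (LocalSubring.le_ofPrime A Q a.2) (Subtype.prop _)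

/-- The valuation of `V = A_Q` is at most one on `A`, and less than one exactly on `Q`. -/
theorem valuation_lt_one_iff_mem {A : Subring L} {Q : Ideal A} [Q.IsPrime] {V : ValuationSubring L}
    (hV : V.toLocalSubring = LocalSubring.ofPrime A Q) (a : A) : V.valuation a < 1 ↔ a ∈ Q := by
  have hVmem : ∀ z : L, z ∈ V ↔ ∃ a b : A, b ∉ Q ∧ z = a / b := fun z => by
    rw [← mem_ofPrime, ← hV]; rfl
  constructor
  · intro ha
    by_contra haQ
    have ha0 : (a : L) ≠ 0 := fun h0 => haQ ((Subtype.ext h0 : a = 0) ▸ Q.zero_mem)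
    have hinv : (a : L)⁻¹ ∈ V := (hVmem _).2 ⟨1, a, haQ, by simp⟩
    have h1 := (V.valuation_le_one_iff _).2 hinv
    rw [map_inv₀] at h1
    have h3 : V.valuation (a : L) * (V.valuation (a : L))⁻¹ = 1 :=
      mul_inv_cancel₀ (by simpa using ha0)
    have h2 : V.valuation (a : L) * (V.valuation (a : L))⁻¹ < 1 :=
      mul_lt_one_of_lt_of_le ha h1
    exact h2.ne h3
  · intro ha
    have hle : V.valuation (a : L) ≤ 1 := (V.valuation_le_one_iff _).2
      ((hVmem _).2 ⟨a, 1, (Ideal.ne_top_iff_one Q).1 (Ideal.IsPrime.ne_top ‹_›), by simp⟩)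
    refine lt_of_le_of_ne hle fun h1 => ?_
    have ha0 : (a : L) ≠ 0 := fun h0 => by rw [h0, map_zero] at h1; exact zero_ne_one h1
    have hinv : (a : L)⁻¹ ∈ V := (V.valuation_le_one_iff _).1 (by rw [map_inv₀, h1, inv_one])
    obtain ⟨c, b, hb, h⟩ := (hVmem _).1 hinv
    have hb0 : (b : L) ≠ 0 := fun h0 => hb ((Subtype.ext h0 : b = 0) ▸ Q.zero_mem)
    have : b = a * c := Subtype.ext (by
      rw [inv_eq_one_div, div_eq_div_iff ha0 hb0, one_mul] at h
      rw [h, mul_comm]; rfl)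
    exact hb (this ▸ Q.mul_mem_right c ha)

/-- A common rescaling turns an integral equation over a larger ring into one over `B`. -/
theorem isIntegral_mul_of_coeff_mem (B : Subring L) {p : L[X]} (hp : p.Monic) {a s : L}
    (ha : p.eval a = 0) (hs : s ∈ B) (h : ∀ i < p.natDegree, p.coeff i * s ∈ B) :
    IsIntegral B (s * a) := by
  have hcoeff : ∀ i, (p.scaleRoots s).coeff i ∈ B := by
    intro i
    rw [coeff_scaleRoots]
    rcases lt_trichotomy i p.natDegree with hi | rfl | hi
    · obtain ⟨k, hk⟩ := Nat.exists_eq_succ_of_ne_zero (Nat.sub_ne_zero_of_lt hi)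
      rw [hk, pow_succ', ← mul_assoc]
      exact mul_mem (h i hi) (pow_mem hs k)
    · rw [hp.coeff_natDegree, Nat.sub_self, pow_zero, one_mul]
      exact one_mem B
    · rw [coeff_eq_zero_of_natDegree_lt hi, zero_mul]
      exact zero_mem B
  have hsub : (↑(p.scaleRoots s).coeffs : Set L) ⊆ B := fun c hc => by
    obtain ⟨i, _, rfl⟩ := mem_coeffs_iff.1 (Finset.mem_coe.1 hc)
    exact hcoeff i
  refine ⟨(p.scaleRoots s).toSubring B hsub, ?_, ?_⟩
  · rw [monic_toSubring, monic_scaleRoots_iff]; exact hp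
  · rw [← eval_map]
    have : ((p.scaleRoots s).toSubring B hsub).map (algebraMap B L) = p.scaleRoots s :=
      map_toSubring _ _ _
    rw [this]
    exact (p.scaleRoots_eval_mul a s).trans (by rw [ha, mul_zero])

end LocalSubrings

/-! ### The charts of the blowup -/

section Charts

variable {R : Type u} [CommRing R] {L : Type v} [Field L] [Algebra R L] {I : Ideal R}

theorem mem_blowupChart_iff {x : R} (hx : x ∈ I) (hx0 : algebraMap R L x ≠ 0) {a : L} :
    a ∈ blowupChart L I x ↔
      ∃ n, ∃ f ∈ I ^ n, a = algebraMap R L f / algebraMap R L x ^ n := by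
  constructor
  · intro ha
    change a ∈ Algebra.adjoin R _ at ha
    induction ha using Algebra.adjoin_induction with
    | mem a ha =>
      obtain ⟨y, hy, rfl⟩ := ha
      exact ⟨1, y, by simpa using hy, by simp⟩
    | algebraMap r => exact ⟨0, r, by simp, by simp⟩
    | add a b _ _ ha hb =>
      obtain ⟨n, f, hf, rfl⟩ := ha
      obtain ⟨m, g, hg, rfl⟩ := hb
      refine ⟨n + m, f * x ^ m + g * x ^ n, add_mem (mul_mem_ideal_pow hf (Ideal.pow_mem_pow hx m))
        (add_comm n m ▸ mul_mem_ideal_pow hg (Ideal.pow_mem_pow hx n)), ?_⟩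
      simp only [map_add, map_mul, map_pow]
      field_simp
      ring
    | mul a b _ _ ha hb =>
      obtain ⟨n, f, hf, rfl⟩ := ha
      obtain ⟨m, g, hg, rfl⟩ := hb
      refine ⟨n + m, f * g, mul_mem_ideal_pow hf hg, ?_⟩
      simp only [map_mul]
      field_simp
      ring
  · rintro ⟨n, f, hf, rfl⟩
    induction n generalizing f with
    | zero =>
      rw [pow_zero, div_one]
      exact (Algebra.adjoin R _).algebraMap_mem f
    | succ n ih =>
      rw [pow_succ] at hf
      refine Submodule.mul_induction_on hf (fun g hg y hy => ?_) fun g g' hg hg' => ?_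
      · have h1 := mul_mem (ih g hg)
          (Algebra.subset_adjoin ⟨y, hy, rfl⟩ : _ ∈ Algebra.adjoin R
            {z : L | ∃ y ∈ I, z = algebraMap R L y / algebraMap R L x})
        convert h1 using 1
        rw [map_mul, pow_succ, div_mul_div_comm]
      · rw [map_add, add_div]
        exact add_mem hg hg'

theorem mem_blowupChart_of_le {x : R} (hx : x ∈ I) (hx0 : algebraMap R L x ≠ 0) {a : L}
    (ha : a ∈ blowupChart L I x) :
    ∃ n₀, ∀ n, n₀ ≤ n → ∃ f ∈ I ^ n, a = algebraMap R L f / algebraMap R L x ^ n := by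
  obtain ⟨n₀, f, hf, rfl⟩ := (mem_blowupChart_iff hx hx0).1 ha
  refine ⟨n₀, fun n hn => ⟨f * x ^ (n - n₀), ?_, ?_⟩⟩
  · have := mul_mem_ideal_pow hf (Ideal.pow_mem_pow hx (n - n₀))
    rwa [Nat.add_sub_cancel' hn] at this
  · rw [map_mul, map_pow, ← Nat.add_sub_cancel' hn, pow_add, Nat.add_sub_cancel_left]
    field_simp

theorem algebraMap_mem_blowupChart (x : R) (r : R) : algebraMap R L r ∈ blowupChart L I x :=
  (Algebra.adjoin R _).algebraMap_mem r

instance (x : R) : Algebra R (blowupChart L I x) :=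
  inferInstanceAs (Algebra R (Algebra.adjoin R
    {z : L | ∃ y ∈ I, z = algebraMap R L y / algebraMap R L x}))

theorem coe_algebraMap_blowupChart (x r : R) :
    (algebraMap R (blowupChart L I x) r : L) = algebraMap R L r := rfl

instance finiteType_blowupChart [IsNoetherianRing R] (x : R) :
    Algebra.FiniteType R (blowupChart L I x) := by
  obtain ⟨T, hT⟩ := (isNoetherianRing_iff_ideal_fg R).1 inferInstance I
  have h : Algebra.adjoin R {z : L | ∃ y ∈ I, z = algebraMap R L y / algebraMap R L x} =
      Algebra.adjoin R ((fun y => algebraMap R L y / algebraMap R L x) '' (T : Set R)) := by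
    refine le_antisymm (Algebra.adjoin_le ?_) (Algebra.adjoin_mono ?_)
    · rintro _ ⟨y, hy, rfl⟩
      rw [← hT] at hy
      induction hy using Submodule.span_induction with
      | mem y hy => exact Algebra.subset_adjoin ⟨y, hy, rfl⟩
      | zero => simp
      | add y z _ _ hy hz => rw [map_add, add_div]; exact add_mem hy hz
      | smul r y _ hy =>
        rw [smul_eq_mul, map_mul, mul_div_assoc, ← Algebra.smul_def]
        exact Subalgebra.smul_mem _ hy r
    · rintro _ ⟨y, hy, rfl⟩
      exact ⟨y, hT ▸ Ideal.subset_span hy, rfl⟩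
  have hfg : (Algebra.adjoin R
      {z : L | ∃ y ∈ I, z = algebraMap R L y / algebraMap R L x}).FG := by
    rw [h]
    exact Subalgebra.fg_def.2 ⟨_, T.finite_toSet.image _, rfl⟩
  exact (Subalgebra.fg_iff_finiteType _).1 hfg

instance isNoetherianRing_blowupChart [IsNoetherianRing R] (x : R) :
    IsNoetherianRing (blowupChart L I x) :=
  Algebra.FiniteType.isNoetherianRing R _

theorem isFractionRing_of_algebraMap_mem [IsDomain R] [IsFractionRing R L] (A : Subring L)
    (hA : ∀ r : R, algebraMap R L r ∈ A) : IsFractionRing A L := by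
  refine IsFractionRing.of_field A L fun z => ?_
  obtain ⟨r, s, _, rfl⟩ := IsFractionRing.div_surjective (A := R) z
  exact ⟨⟨_, hA r⟩, ⟨_, hA s⟩, rfl⟩

/-- If all powers of `I` are complete, the charts of the blowup of `I` are normal: for `a` integral
over `R[I x⁻¹]` and large `N`, the element `a x ^ N` is integral over the ideal `I ^ N`, so it has
at least the value of `I ^ N` at every valuation ring that contains `R`. -/
theorem isIntegrallyClosed_blowupChart [IsDomain R] [IsNoetherianRing R] [IsIntegrallyClosed R]
    [IsFractionRing R L] (hI : IsNormalIdeal L I) {x : R} (hx : x ∈ I) (hx0 : x ≠ 0) :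
    IsIntegrallyClosed (blowupChart L I x) := by
  have hxL : algebraMap R L x ≠ 0 := by simpa using hx0
  have := isFractionRing_of_algebraMap_mem (R := R) (blowupChart L I x)
    (algebraMap_mem_blowupChart x)
  refine (isIntegrallyClosed_iff L).2 fun {a} ha => ?_
  obtain ⟨p, hp, hpa⟩ := ha
  set q : L[X] := p.map (algebraMap _ L) with hq
  have hqm : q.Monic := hp.map _
  have hqa : q.eval a = 0 := by rw [hq, eval_map]; exact hpa
  have hqc : ∀ i, q.coeff i ∈ blowupChart L I x := fun i => by
    rw [hq, coeff_map]; exact (p.coeff i).2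
  choose n₀ hn₀ using fun i => mem_blowupChart_of_le hx hxL (hqc i)
  -- One exponent that clears the denominators of all coefficients.
  obtain ⟨N, hN1, hN⟩ : ∃ N, 1 ≤ N ∧ ∀ i < q.natDegree, ∃ f ∈ I ^ N,
      q.coeff i = algebraMap R L f / algebraMap R L x ^ N := by
    refine ⟨(Finset.range q.natDegree).sup n₀ + 1, by omega, fun i hi => hn₀ i _ ?_⟩
    exact (Finset.le_sup (f := n₀) (Finset.mem_range.2 hi)).trans (Nat.le_succ _)
  have hxN : algebraMap R L x ^ N ≠ 0 := pow_ne_zero _ hxL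
  obtain ⟨b, hb⟩ : ∃ b : R, algebraMap R L b = algebraMap R L x ^ N * a := by
    have hint : IsIntegral (algebraMap R L).range (algebraMap R L x ^ N * a) := by
      refine isIntegral_mul_of_coeff_mem _ hqm hqa ⟨x ^ N, map_pow _ _ _⟩ fun i hi => ?_
      obtain ⟨f, _, hf⟩ := hN i hi
      exact ⟨f, by rw [hf, div_mul_cancel₀ _ hxN]⟩
    have hint' : IsIntegral R (algebraMap R L x ^ N * a) := by
      obtain ⟨p, hp, hpa⟩ := hint
      obtain ⟨p', hp', hdeg, hmonic⟩ := lifts_and_natDegree_eq_and_monic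
        (f := (algebraMap R L).rangeRestrict) ((mem_lifts _).2
          (map_surjective _ (algebraMap R L).rangeRestrict_surjective p)) hp
      refine ⟨p', hmonic, ?_⟩
      rw [← hp', eval₂_map] at hpa
      exact hpa
    exact IsIntegrallyClosed.isIntegral_iff.1 hint'
  have hbI : b ∈ I ^ N := by
    obtain ⟨F, hF⟩ := hI N hN1
    refine (hF b).2 fun V hV => ?_
    obtain ⟨z, hz, hmax⟩ := exists_value_max V hV (I ^ N)
    have hz0 : algebraMap R L z ≠ 0 := by
      intro h0
      have := hmax _ (Ideal.pow_mem_pow hx N)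
      rw [value, value, h0, map_zero, le_zero_iff, map_eq_zero, map_pow] at this
      exact hxN this
    have hdiv : ∀ f ∈ I ^ N, algebraMap R L f / algebraMap R L z ∈ V := fun f hf => by
      rw [← V.valuation_le_one_iff, map_div₀]
      exact div_le_one_of_le₀ (hmax f hf) zero_le
    have hint : IsIntegral V.toSubring (algebraMap R L x ^ N / algebraMap R L z * a) := by
      refine isIntegral_mul_of_coeff_mem _ hqm hqa ?_ fun i hi => ?_
      · rw [← map_pow]
        exact hdiv _ (Ideal.pow_mem_pow hx N)
      · obtain ⟨f, hfI, hf⟩ := hN i hi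
        rw [hf, div_mul_div_cancel₀ hxN]
        exact hdiv f hfI
    obtain ⟨w, hw⟩ : ∃ w : V, (w : L) = algebraMap R L x ^ N / algebraMap R L z * a :=
      IsIntegrallyClosed.isIntegral_iff.1 (show IsIntegral V _ from hint)
    have : (⟨algebraMap R L b, hV b⟩ : V) = w * ⟨algebraMap R L z, hV z⟩ := Subtype.ext (by
      change algebraMap R L b = w * algebraMap R L z
      rw [hb, hw]; field_simp)
    rw [this]
    exact Ideal.mul_mem_left _ _ ((hF z).1 hz V hV)
  refine ⟨⟨a, (mem_blowupChart_iff hx hxL).2 ⟨N, b, hbI, ?_⟩⟩, rfl⟩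
  rw [hb, mul_div_cancel_left₀ _ hxN]

end Charts

/-! ### Dicritical divisors as localizations of charts -/

theorem exists_notMem_mul_pow_mem {A : Type*} [CommRing A] {J Q : Ideal A}
    (hQ : Q ∈ J.minimalPrimes) {q : A} (hq : q ∈ Q) : ∃ g ∉ Q, ∃ k : ℕ, g * q ^ k ∈ J := by
  have := hQ.1.1
  have h1 : algebraMap A (Localization.AtPrime Q) q ∈
      (J.map (algebraMap A (Localization.AtPrime Q))).radical := by
    rw [IsLocalization.AtPrime.radical_map_of_mem_minimalPrimes (Localization.AtPrime Q) Q J hQ]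
    exact Ideal.mem_map_of_mem _ hq
  obtain ⟨k, hk⟩ := h1
  rw [← map_pow, IsLocalization.algebraMap_mem_map_algebraMap_iff Q.primeCompl] at hk
  obtain ⟨g, hg, h⟩ := hk
  exact ⟨g, hg, k, h⟩

section Divisors

variable {R : Type u} [CommRing R] [IsLocalRing R] [IsNoetherianRing R]
  {L : Type v} [Field L] [Algebra R L] [IsFractionRing R L] {I : Ideal R}

omit [IsLocalRing R] [IsNoetherianRing R] in
theorem algebraMap_frac_ne_zero {x : R} (hx : x ≠ 0) : algebraMap R L x ≠ 0 := by
  simpa using hx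

omit [IsNoetherianRing R] in
theorem range_le_toLocalSubring_iff (V : ValuationSubring L) :
    LocalSubring.range (algebraMap R L) ≤ V.toLocalSubring ↔
      (∀ r : R, algebraMap R L r ∈ V) ∧
        ∀ r ∈ IsLocalRing.maximalIdeal R, V.valuation (algebraMap R L r) < 1 := by
  constructor
  · rintro ⟨hle, hloc⟩
    have hmem : ∀ r : R, algebraMap R L r ∈ V := fun r => hle ⟨r, rfl⟩
    refine ⟨hmem, fun r hr => lt_of_le_of_ne ((V.valuation_le_one_iff _).2 (hmem r)) fun h1 => ?_⟩
    have hu : IsUnit (⟨algebraMap R L r, hmem r⟩ : V) := (V.valuation_eq_one_iff _).2 h1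
    have hu' : IsUnit (⟨algebraMap R L r, ⟨r, rfl⟩⟩ :
        (LocalSubring.range (algebraMap R L)).toSubring) := hloc.map_nonunit _ hu
    obtain ⟨⟨_, s, rfl⟩, hs⟩ := isUnit_iff_exists_inv.1 hu'
    have hs' : algebraMap R L (r * s) = algebraMap R L 1 := by
      rw [map_mul, map_one]; exact congrArg Subtype.val hs
    exact (IsLocalRing.mem_maximalIdeal r).1 hr
      (isUnit_iff_exists_inv.2 ⟨s, IsFractionRing.injective R L hs'⟩)
  · rintro ⟨hmem, hlt⟩
    have hle : (LocalSubring.range (algebraMap R L)).toSubring ≤ V.toLocalSubring.toSubring := by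
      rintro _ ⟨r, rfl⟩
      exact hmem r
    refine ⟨hle, ⟨?_⟩⟩
    rintro ⟨_, r, rfl⟩ hu
    have h1 : V.valuation (algebraMap R L r) = 1 :=
      (V.valuation_eq_one_iff (⟨_, hmem r⟩ : V)).1 hu
    have hr : IsUnit r := by
      by_contra hr
      exact (hlt r ((IsLocalRing.mem_maximalIdeal r).2 hr)).ne h1
    exact hr.map (algebraMap R L).rangeRestrict

/-- `V` is the localization of the chart `R[I x⁻¹]` at a minimal prime `Q` of the ideal generated
by `x`. -/
structure IsChart (I : Ideal R) (V : ValuationSubring L) (x : R) (Q : Ideal (blowupChart L I x)) :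
    Prop where
  mem : x ∈ I
  ne_zero : x ≠ 0
  minimal : Q ∈ (Ideal.span {algebraMap R (blowupChart L I x) x}).minimalPrimes
  eq : V.toLocalSubring = @LocalSubring.ofPrime _ _ (blowupChart L I x) Q minimal.1.1

section Charts

variable (hrad : I.radical = IsLocalRing.maximalIdeal R) (hI : IsNormalIdeal L I)

include hrad in
omit [IsNoetherianRing R] in
theorem le_maximalIdeal_of_radical_eq : I ≤ IsLocalRing.maximalIdeal R :=
  hrad ▸ Ideal.le_radical

include hI in
omit [IsLocalRing R] in
theorem exists_toLocalSubring_eq_ofPrime [IsDomain R] [IsIntegrallyClosed R] {x : R} (hx : x ∈ I)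
    (hx0 : x ≠ 0)
    (Q : Ideal (blowupChart L I x)) [Q.IsPrime]
    (hdim : ringKrullDim (LocalSubring.ofPrime _ Q).toSubring = 1) :
    IsDiscreteValuationRing (LocalSubring.ofPrime _ Q).toSubring ∧
      ∃ V : ValuationSubring L, V.toLocalSubring = LocalSubring.ofPrime _ Q := by
  have := isIntegrallyClosed_blowupChart hI hx hx0
  have : IsIntegrallyClosed (LocalSubring.ofPrime (blowupChart L I x) Q).toSubring :=
    isIntegrallyClosed_of_isLocalization _ Q.primeCompl Q.primeCompl_le_nonZeroDivisors
  have : IsNoetherianRing (LocalSubring.ofPrime (blowupChart L I x) Q).toSubring :=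
    IsLocalization.isNoetherianRing Q.primeCompl _ inferInstance
  have hdvr := isDiscreteValuationRing_of_ringKrullDim_eq_one _ hdim
  have := isFractionRing_of_algebraMap_mem (R := R) (L := L)
    (LocalSubring.ofPrime (blowupChart L I x) Q).toSubring
    fun r => LocalSubring.le_ofPrime _ _ (algebraMap_mem_blowupChart x r)
  exact ⟨hdvr, exists_toLocalSubring_eq _⟩

omit [IsLocalRing R] [IsNoetherianRing R] in
theorem algebraMap_blowupChart_ne_zero {x : R} (hx0 : x ≠ 0) :
    algebraMap R (blowupChart L I x) x ≠ 0 := fun h =>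
  (by simpa using hx0 : algebraMap R L x ≠ 0) (congrArg Subtype.val h)

omit [IsLocalRing R] in
/-- By Krull's principal ideal theorem the minimal primes of the ideal generated by `x` have height
one. -/
theorem ringKrullDim_ofPrime_eq_one {x : R} (hx0 : x ≠ 0) (Q : Ideal (blowupChart L I x))
    [Q.IsPrime] (hQ : Q ∈ (Ideal.span {algebraMap R (blowupChart L I x) x}).minimalPrimes) :
    ringKrullDim (LocalSubring.ofPrime _ Q).toSubring = 1 := by
  rw [IsLocalization.AtPrime.ringKrullDim_eq_height Q]
  have h1 : Q.height ≤ 1 := Ideal.height_le_one_of_isPrincipal_of_mem_minimalPrimes _ Q hQ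
  have h2 : 1 ≤ Q.height := (Ideal.one_le_height_span_singleton_of_mem_nonZeroDivisors
    (mem_nonZeroDivisors_iff_ne_zero.2 (algebraMap_blowupChart_ne_zero hx0))).trans
      (Ideal.height_mono hQ.1.2)
  rw [le_antisymm h1 h2]
  rfl

include hrad in
omit [IsNoetherianRing R] in
theorem range_le_of_isChart {V : ValuationSubring L} {x : R} {Q : Ideal (blowupChart L I x)}
    (h : IsChart I V x Q) : LocalSubring.range (algebraMap R L) ≤ V.toLocalSubring := by
  have hQp := h.minimal.1.1
  have hxL := algebraMap_frac_ne_zero (L := L) h.ne_zero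
  refine (range_le_toLocalSubring_iff V).2 ⟨fun r => ?_, fun r hr => ?_⟩
  · have : algebraMap R L r ∈ V.toLocalSubring.toSubring := by
      rw [h.eq]; exact LocalSubring.le_ofPrime _ _ (algebraMap_mem_blowupChart x r)
    exact this
  · change V.valuation (algebraMap R (blowupChart L I x) r : L) < 1
    rw [valuation_lt_one_iff_mem h.eq]
    rw [← hrad] at hr
    obtain ⟨k, hk⟩ := hr
    refine hQp.mem_of_pow_mem k (h.minimal.1.2 (Ideal.mem_span_singleton'.2
      ⟨⟨algebraMap R L (r ^ k) / algebraMap R L x,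
        (mem_blowupChart_iff h.mem hxL).2 ⟨1, _, by simpa using hk, by simp⟩⟩, ?_⟩))
    refine Subtype.ext ?_
    exact (div_mul_cancel₀ (algebraMap R L (r ^ k)) hxL).trans (map_pow (algebraMap R L) r k)

include hrad in
theorem IsChart.mem_dicriticalDivisors {V : ValuationSubring L} {x : R}
    {Q : Ideal (blowupChart L I x)} (h : IsChart I V x Q) : V ∈ dicriticalDivisors L I := by
  have hQp := h.minimal.1.1
  refine ⟨LocalSubring.ofPrime _ Q, ⟨⟨x, h.mem, h.ne_zero, Q, hQp, rfl⟩,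
    ringKrullDim_ofPrime_eq_one h.ne_zero Q h.minimal, ?_⟩, ?_⟩
  · rw [← h.eq]; exact range_le_of_isChart hrad h
  · rw [← h.eq, normalizationSet_toLocalSubring]; rfl

include hrad hI in
theorem exists_isChart_of_mem_dicriticalSet [IsDomain R] [IsIntegrallyClosed R] {T : LocalSubring L}
    (hT : T ∈ dicriticalSet L I) :
    IsDiscreteValuationRing T.toSubring ∧
      ∃ (V : ValuationSubring L) (x : R) (Q : Ideal (blowupChart L I x)),
        V.toLocalSubring = T ∧ IsChart I V x Q := by
  obtain ⟨_, ⟨⟨x, hx, hx0, Q, hQ, rfl⟩, hdim, hdom⟩, hT⟩ := hT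
  obtain ⟨hdvr, V, hV⟩ := exists_toLocalSubring_eq_ofPrime hI hx hx0 Q hdim
  rw [← hV, normalizationSet_toLocalSubring, Set.mem_singleton_iff] at hT
  have hxA : algebraMap R (blowupChart L I x) x ≠ 0 := algebraMap_blowupChart_ne_zero hx0
  have hxQ : algebraMap R (blowupChart L I x) x ∈ Q := by
    rw [← valuation_lt_one_iff_mem hV]
    rw [← hV] at hdom
    exact ((range_le_toLocalSubring_iff V).1 hdom).2 x (le_maximalIdeal_of_radical_eq hrad hx)
  have hht : Q.height = 1 := by
    rw [IsLocalization.AtPrime.ringKrullDim_eq_height Q] at hdim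
    exact_mod_cast hdim
  have : Q.FiniteHeight := ⟨Or.inr (by rw [hht]; exact ENat.one_ne_top)⟩
  have hmin : Q ∈ (Ideal.span {algebraMap R (blowupChart L I x) x}).minimalPrimes := by
    refine Ideal.mem_minimalPrimes_of_height_le
      ((Ideal.span_singleton_le_iff_mem _).2 hxQ) ?_
    rw [hht]
    exact Ideal.one_le_height_span_singleton_of_mem_nonZeroDivisors
      (mem_nonZeroDivisors_iff_ne_zero.2 hxA)
  exact ⟨by rw [hT, hV]; exact hdvr, V, x, Q, hT.symm, hx, hx0, hmin, hV⟩

include hrad hI in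
theorem exists_isChart [IsDomain R] [IsIntegrallyClosed R] (V : dicriticalDivisors L I) :
    ∃ (x : R) (Q : Ideal (blowupChart L I x)), IsChart I V.1 x Q := by
  obtain ⟨_, V', x, Q, hV', h⟩ := exists_isChart_of_mem_dicriticalSet hrad hI V.2
  rw [ValuationSubring.toLocalSubring_injective hV'] at h
  exact ⟨x, Q, h⟩

include hrad hI in
/-- Every minimal prime `Q` of the ideal generated by `x` in its chart gives a dicritical divisor.
-/
theorem exists_isChart_of_mem_minimalPrimes [IsDomain R] [IsIntegrallyClosed R] {x : R} (hx : x ∈ I)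
    (hx0 : x ≠ 0) {Q : Ideal (blowupChart L I x)}
    (hQ : Q ∈ (Ideal.span {algebraMap R (blowupChart L I x) x}).minimalPrimes) :
    ∃ V : dicriticalDivisors L I, IsChart I V.1 x Q := by
  have := hQ.1.1
  obtain ⟨_, V, hV⟩ := exists_toLocalSubring_eq_ofPrime hI hx hx0 Q
    (ringKrullDim_ofPrime_eq_one hx0 Q hQ)
  have h : IsChart I V x Q := ⟨hx, hx0, hQ, hV⟩
  exact ⟨⟨V, h.mem_dicriticalDivisors hrad⟩, h⟩

include hrad hI in
/-- Take a valuation ring dominating `R` and `x ∈ I` of minimal additive value: it contains the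
chart of `x`, in which `x` is therefore not a unit. -/
theorem nonempty_dicriticalDivisors [IsDomain R] [IsIntegrallyClosed R] (hI0 : I ≠ ⊥) :
    Nonempty (dicriticalDivisors L I) := by
  obtain ⟨V, hV⟩ := (LocalSubring.range (algebraMap R L)).exists_le_valuationSubring
  obtain ⟨hmem, hlt⟩ := (range_le_toLocalSubring_iff V).1 hV
  obtain ⟨x, hx, hmax⟩ := exists_value_max V hmem I
  have hx0 : x ≠ 0 := by
    rintro rfl
    obtain ⟨y, hy, hy0⟩ := Submodule.exists_mem_ne_zero_of_ne_bot hI0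
    have := hmax y hy
    rw [value, value, map_zero, map_zero, le_zero_iff, map_eq_zero] at this
    exact algebraMap_frac_ne_zero hy0 this
  have hle : blowupChart L I x ≤ V.toSubring := by
    intro a ha
    change a ∈ Algebra.adjoin R _ at ha
    induction ha using Algebra.adjoin_induction with
    | mem a ha =>
      obtain ⟨y, hy, rfl⟩ := ha
      change _ ∈ V
      rw [← V.valuation_le_one_iff, map_div₀]
      exact div_le_one_of_le₀ (hmax y hy) zero_le
    | algebraMap r => exact hmem r
    | add a b _ _ ha hb => exact add_mem ha hb
    | mul a b _ _ ha hb => exact mul_mem ha hb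
  have htop : Ideal.span {algebraMap R (blowupChart L I x) x} ≠ ⊤ := by
    rw [Ne, Ideal.span_singleton_eq_top]
    intro hu
    obtain ⟨b, hb⟩ := isUnit_iff_exists_inv.1 hu
    have h1 : algebraMap R L x * b = 1 := congrArg Subtype.val hb
    have h2 : V.valuation (algebraMap R L x) * V.valuation (b : L) < 1 :=
      mul_lt_one_of_lt_of_le (hlt x (le_maximalIdeal_of_radical_eq hrad hx))
        ((V.valuation_le_one_iff _).2 (hle b.2))
    rw [← map_mul, h1, map_one] at h2
    exact lt_irrefl _ h2
  obtain ⟨Q, hQ⟩ := Ideal.nonempty_minimalPrimes htop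
  obtain ⟨V', _⟩ := exists_isChart_of_mem_minimalPrimes hrad hI hx hx0 hQ
  exact ⟨V'⟩

end Charts

/-! ### The primes of the Rees ring belonging to the dicritical divisors -/

section Primes

omit [IsLocalRing R] in
theorem idealValue_ne_zero (V : ValuationSubring L) (hV : ∀ r : R, algebraMap R L r ∈ V)
    (hI0 : I ≠ ⊥) : idealValue V I ≠ 0 := by
  intro h
  obtain ⟨y, hy, hy0⟩ := Submodule.exists_mem_ne_zero_of_ne_bot hI0
  have := (idealValue_isGreatest V hV I).2 ⟨y, hy, rfl⟩
  rw [h, le_zero_iff, value, map_eq_zero] at this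
  exact algebraMap_frac_ne_zero hy0 this

omit [IsLocalRing R] in
theorem coe_idealWeight (V : ValuationSubring L) (hV : ∀ r : R, algebraMap R L r ∈ V)
    (hI0 : I ≠ ⊥) : (idealWeight V I : V.ValueGroup) = (idealValue V I)⁻¹ := by
  rw [idealWeight, dif_neg (idealValue_ne_zero V hV hI0)]
  rfl

omit [IsLocalRing R] in
theorem idealValue_pow (V : ValuationSubring L) (hV : ∀ r : R, algebraMap R L r ∈ V)
    (hI0 : I ≠ ⊥) (n : ℕ) : idealValue V (I ^ n) = idealValue V I ^ n := by
  refine (idealValue_isGreatest V hV (I ^ n)).unique ⟨?_, ?_⟩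
  · obtain ⟨x, hx, h⟩ := (idealValue_isGreatest V hV I).1
    exact ⟨x ^ n, Ideal.pow_mem_pow hx n, by rw [← h, value, value, map_pow, map_pow]⟩
  · rintro _ ⟨x, hx, rfl⟩
    have := value_mul_idealWeight_pow_le_one V hV I n x hx
    rwa [coe_idealWeight V hV hI0, inv_pow, ← div_eq_mul_inv,
      div_le_one₀ (pow_pos (zero_lt_iff.2 (idealValue_ne_zero V hV hI0)) n)] at this

theorem mem_dicriticalPrime_iff (V : dicriticalDivisors L I) (f : reesAlgebra I) :
    f ∈ dicriticalPrime V ↔ ∀ n, value V.1 ((f : R[X]).coeff n) *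
      (idealWeight V.1 I : V.1.ValueGroup) ^ n < 1 := by
  rw [dicriticalPrime, reesCenter, Ideal.mem_comap, ValuationSubring.valuation_lt_one_iff]
  refine (Valuation.isEquiv_valuation_valuationSubring
    (reesValuation V.1 I)).lt_one_iff_lt_one.symm.trans ?_
  change reesValuation V.1 I (algebraMap L[X] (RatFunc L) (map (algebraMap R L) (f : R[X]))) < 1 ↔ _
  rw [reesValuation, gaussValuation_algebraMap,
    Finset.sup_lt_iff (bot_le.trans_lt (zero_lt_iff.2 one_ne_zero))]
  simp only [coeff_map]
  refine ⟨fun h n => ?_, fun h n _ => h n⟩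
  by_cases hn : (f : R[X]).coeff n = 0
  · simp [hn, value]
  · refine h n ?_
    rw [mem_support_iff, coeff_map]
    exact algebraMap_frac_ne_zero hn

theorem reesMonomial_mem_dicriticalPrime_iff (V : dicriticalDivisors L I) {n : ℕ} {a : R}
    (ha : a ∈ I ^ n) : reesMonomial ha ∈ dicriticalPrime V ↔
      value V.1 a * (idealWeight V.1 I : V.1.ValueGroup) ^ n < 1 := by
  rw [mem_dicriticalPrime_iff]
  refine ⟨fun h => by simpa [reesMonomial] using h n, fun h m => ?_⟩
  by_cases hm : n = m
  · subst hm; simpa [reesMonomial] using h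
  · simp [reesMonomial, coeff_monomial, hm, value]

theorem mem_dicriticalPrime_iff_reesMonomial (V : dicriticalDivisors L I) (f : reesAlgebra I) :
    f ∈ dicriticalPrime V ↔ ∀ n, reesMonomial (f.2 n) ∈ dicriticalPrime V := by
  rw [mem_dicriticalPrime_iff]
  simp only [reesMonomial_mem_dicriticalPrime_iff]

/-- An element `a` of `Iⁿ` has minimal additive value on `Iⁿ` if and only if `a Zⁿ` is not in
`P*`. -/
theorem value_eq_idealValue_pow_iff (hI0 : I ≠ ⊥) (V : dicriticalDivisors L I) {n : ℕ} {a : R}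
    (ha : a ∈ I ^ n) :
    value V.1 a = idealValue V.1 (I ^ n) ↔ reesMonomial ha ∉ dicriticalPrime V := by
  have hV : ∀ r : R, algebraMap R L r ∈ V.1 := algebraMap_mem_of_mem_dicriticalDivisors V.2
  have hpos : 0 < idealValue V.1 I ^ n :=
    pow_pos (zero_lt_iff.2 (idealValue_ne_zero V.1 hV hI0)) n
  have hle : value V.1 a ≤ idealValue V.1 (I ^ n) :=
    (idealValue_isGreatest V.1 hV (I ^ n)).2 ⟨a, ha, rfl⟩
  rw [idealValue_pow V.1 hV hI0] at hle ⊢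
  rw [reesMonomial_mem_dicriticalPrime_iff, coe_idealWeight V.1 hV hI0, inv_pow,
    ← div_eq_mul_inv, div_lt_one₀ hpos, not_lt]
  exact ⟨fun h => h.ge, fun h => le_antisymm hle h⟩

theorem value_eq_idealValue_iff (hI0 : I ≠ ⊥) (V : dicriticalDivisors L I) (x : I) :
    value V.1 (x : R) = idealValue V.1 I ↔ reesDegreeOne x ∉ dicriticalPrime V := by
  have hV : ∀ r : R, algebraMap R L r ∈ V.1 := algebraMap_mem_of_mem_dicriticalDivisors V.2
  rw [reesDegreeOne_eq, ← value_eq_idealValue_pow_iff hI0 V, idealValue_pow V.1 hV hI0, pow_one]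

omit [IsFractionRing R L] in
theorem isPrime_dicriticalPrime (V : dicriticalDivisors L I) : (dicriticalPrime V).IsPrime :=
  Ideal.IsPrime.comap _

/-- The element `f / xⁿ` of the chart, for `f ∈ Iⁿ`. -/
def chartElem {x : R} (hx : x ∈ I) (hx0 : x ≠ 0) {n : ℕ} {f : R} (hf : f ∈ I ^ n) :
    blowupChart L I x :=
  ⟨algebraMap R L f / algebraMap R L x ^ n,
    (mem_blowupChart_iff hx (algebraMap_frac_ne_zero hx0)).2 ⟨n, f, hf, rfl⟩⟩

omit [IsLocalRing R] [IsNoetherianRing R] in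
theorem exists_chartElem_eq {x : R} (hx : x ∈ I) (hx0 : x ≠ 0) (a : blowupChart L I x) :
    ∃ (n : ℕ) (f : R) (hf : f ∈ I ^ n), a = chartElem hx hx0 hf := by
  obtain ⟨n, f, hf, h⟩ := (mem_blowupChart_iff hx (algebraMap_frac_ne_zero hx0)).1 a.2
  exact ⟨n, f, hf, Subtype.ext h⟩

namespace IsChart

variable {V : dicriticalDivisors L I} {x : R} {Q : Ideal (blowupChart L I x)}

theorem idealValue_eq (h : IsChart I V.1 x Q) : idealValue V.1 I = value V.1 x := by
  have hV : ∀ r : R, algebraMap R L r ∈ V.1 := algebraMap_mem_of_mem_dicriticalDivisors V.2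
  have := h.minimal.1.1
  have hxL := algebraMap_frac_ne_zero (L := L) h.ne_zero
  refine (idealValue_isGreatest V.1 hV I).unique ⟨⟨x, h.mem, rfl⟩, ?_⟩
  rintro _ ⟨y, hy, rfl⟩
  have h1 : algebraMap R L y / algebraMap R L x ∈ V.1.toLocalSubring.toSubring := by
    rw [h.eq]
    exact LocalSubring.le_ofPrime _ _ ((mem_blowupChart_iff h.mem hxL).2
      ⟨1, y, by simpa using hy, by simp⟩)
  have h2 := (V.1.valuation_le_one_iff _).2 h1
  rw [map_div₀, div_le_one₀ (zero_lt_iff.2 (by simpa using h.ne_zero))] at h2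
  exact h2

theorem chartElem_mem_iff (h : IsChart I V.1 x Q) {n : ℕ} {f : R} (hf : f ∈ I ^ n) :
    chartElem h.mem h.ne_zero hf ∈ Q ↔ reesMonomial hf ∈ dicriticalPrime V := by
  have hV : ∀ r : R, algebraMap R L r ∈ V.1 := algebraMap_mem_of_mem_dicriticalDivisors V.2
  have := h.minimal.1.1
  have hI0 : I ≠ ⊥ := fun h0 => h.ne_zero (by simpa [h0] using h.mem)
  rw [← valuation_lt_one_iff_mem h.eq, reesMonomial_mem_dicriticalPrime_iff,
    coe_idealWeight V.1 hV hI0, h.idealValue_eq]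
  change V.1.valuation (algebraMap R L f / algebraMap R L x ^ n) < 1 ↔ _
  rw [map_div₀, map_pow, div_eq_mul_inv, inv_pow]
  rfl

theorem reesDegreeOne_notMem (h : IsChart I V.1 x Q) :
    reesDegreeOne ⟨x, h.mem⟩ ∉ dicriticalPrime V := by
  have hI0 : I ≠ ⊥ := fun h0 => h.ne_zero (by simpa [h0] using h.mem)
  rw [← value_eq_idealValue_iff hI0]
  exact h.idealValue_eq.symm

/-- `P*` is already minimal over the principal ideal generated by `x`: for `f ∈ Iⁿ` with `f Zⁿ ∈ P*`
the element `f / xⁿ` lies in the minimal prime `Q` of `x`, so that a power of it times an element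
outside `Q` is divisible by `x`; clear denominators. -/
theorem mem_minimalPrimes_span (h : IsChart I V.1 x Q) :
    dicriticalPrime V ∈ (Ideal.span {algebraMap R (reesAlgebra I) x}).minimalPrimes := by
  have hV : ∀ r : R, algebraMap R L r ∈ V.1 := algebraMap_mem_of_mem_dicriticalDivisors V.2
  have hQ := h.minimal.1.1
  have hxL := algebraMap_frac_ne_zero (L := L) h.ne_zero
  have hx1 : x ∈ I ^ 1 := (pow_one I).symm ▸ h.mem
  have hx0 : x ∈ I ^ 0 := by simp
  have halg : algebraMap R (reesAlgebra I) x = reesMonomial hx0 := Subtype.ext rfl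
  refine ⟨⟨isPrime_dicriticalPrime V, ?_⟩, ?_⟩
  · rw [Ideal.span_singleton_le_iff_mem, halg, ← h.chartElem_mem_iff]
    refine h.minimal.1.2 (Ideal.mem_span_singleton'.2 ⟨1, ?_⟩)
    rw [one_mul]
    exact Subtype.ext (by simp [chartElem, coe_algebraMap_blowupChart])
  · intro P' hP'x hle f hf
    obtain ⟨hP', hxP'⟩ := hP'x
    rw [← sum_reesMonomial f]
    refine sum_mem fun n _ => ?_
    have hfn := (mem_dicriticalPrime_iff_reesMonomial V f).1 hf n
    obtain ⟨g, hg, k, hgk⟩ := exists_notMem_mul_pow_mem h.minimal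
      ((h.chartElem_mem_iff (f.2 n)).2 hfn)
    obtain ⟨m, g, hgI, rfl⟩ := exists_chartElem_eq h.mem h.ne_zero g
    obtain ⟨c, hc⟩ := Ideal.mem_span_singleton'.1 hgk
    obtain ⟨l, c, hcI, rfl⟩ := exists_chartElem_eq h.mem h.ne_zero c
    have hcL : (algebraMap R L c / algebraMap R L x ^ l) * algebraMap R L x =
        (algebraMap R L g / algebraMap R L x ^ m) *
          (algebraMap R L ((f : R[X]).coeff n) / algebraMap R L x ^ n) ^ k :=
      congrArg Subtype.val hc
    have hcR : x * c * x ^ (m + n * k) = g * (f : R[X]).coeff n ^ k * x ^ l := by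
      refine IsFractionRing.injective R L ?_
      simp only [map_mul, map_pow]
      rw [div_pow, ← pow_mul, div_mul_div_comm, ← pow_add, div_mul_eq_mul_div,
        div_eq_div_iff (pow_ne_zero _ hxL) (pow_ne_zero _ hxL)] at hcL
      rw [← hcL]; ring
    have hE : reesMonomial hgI * reesMonomial (f.2 n) ^ k * reesMonomial hx1 ^ l =
        algebraMap R (reesAlgebra I) x * (reesMonomial hcI * reesMonomial hx1 ^ (m + n * k)) := by
      rw [halg]
      simp only [reesMonomial_pow, reesMonomial_mul]
      refine reesMonomial_congr (by ring) ?_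
      rw [← hcR]; ring
    have hmem : reesMonomial hgI * reesMonomial (f.2 n) ^ k * reesMonomial hx1 ^ l ∈ P' := by
      rw [hE]
      exact P'.mul_mem_right _ (hxP' (Ideal.mem_span_singleton_self _))
    have hgP : reesMonomial hgI ∉ P' := fun h' => hg ((h.chartElem_mem_iff hgI).2 (hle h'))
    have hxP : reesMonomial hx1 ∉ P' := fun h' => h.reesDegreeOne_notMem (hle h')
    rcases hP'.mem_or_mem hmem with h1 | h1
    · rcases hP'.mem_or_mem h1 with h2 | h2
      · exact absurd h2 hgP
      · exact hP'.mem_of_pow_mem k h2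
    · exact absurd (hP'.mem_of_pow_mem l h1) hxP

end IsChart

end Primes

end Divisors

/-! ### The minimal primes of the extension of the maximal ideal to the Rees ring -/

theorem algebraMap_eq_reesMonomial {R : Type u} [CommRing R] {I : Ideal R} (r : R) :
    algebraMap R (reesAlgebra I) r = reesMonomial (n := 0) (a := r) (by simp) :=
  Subtype.ext rfl

section MinimalPrimes

variable {R : Type u} [CommRing R] [IsLocalRing R] [IsNoetherianRing R]
  {L : Type v} [Field L] [Algebra R L] [IsFractionRing R L] {I : Ideal R}

omit [IsNoetherianRing R] in
/-- Together with `M E` the elements `y Z` generate the homogeneous maximal ideal of the Rees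
ring. -/
theorem mem_of_forall_reesDegreeOne_mem {P : Ideal (reesAlgebra I)}
    (hM : (IsLocalRing.maximalIdeal R).map (algebraMap R (reesAlgebra I)) ≤ P)
    (hU : ∀ y : I, reesDegreeOne y ∈ P) {f : reesAlgebra I}
    (hf : (f : R[X]).coeff 0 ∈ IsLocalRing.maximalIdeal R) : f ∈ P := by
  rw [← sum_reesMonomial f]
  refine sum_mem fun n _ => ?_
  rcases Nat.eq_zero_or_pos n with rfl | hn
  · rw [← algebraMap_eq_reesMonomial]
    exact hM (Ideal.mem_map_of_mem _ hf)
  · refine Ideal.span_le.2 ?_ (Ideal.pow_le_self hn.ne' (reesMonomial_mem_pow_span n (f.2 n)))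
    rintro _ ⟨y, rfl⟩
    exact hU y

omit [IsLocalRing R] [IsNoetherianRing R] in
theorem chartElem_mul {x : R} (hx : x ∈ I) (hx0 : x ≠ 0) {n m : ℕ} {f g : R} (hf : f ∈ I ^ n)
    (hg : g ∈ I ^ m) : (chartElem hx hx0 hf : blowupChart L I x) * chartElem hx hx0 hg =
      chartElem hx hx0 (mul_mem_ideal_pow hf hg) := by
  refine Subtype.ext ?_
  change algebraMap R L f / algebraMap R L x ^ n * (algebraMap R L g / algebraMap R L x ^ m) =
    algebraMap R L (f * g) / algebraMap R L x ^ (n + m)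
  rw [div_mul_div_comm, map_mul, pow_add]

omit [IsLocalRing R] [IsNoetherianRing R] in
theorem chartElem_eq_iff {x : R} (hx : x ∈ I) (hx0 : x ≠ 0) {n m : ℕ} {f g : R} (hf : f ∈ I ^ n)
    (hg : g ∈ I ^ m) : (chartElem hx hx0 hf : blowupChart L I x) = chartElem hx hx0 hg ↔
      f * x ^ m = g * x ^ n := by
  have hxL := algebraMap_frac_ne_zero (L := L) hx0
  rw [Subtype.ext_iff]
  change algebraMap R L f / algebraMap R L x ^ n = algebraMap R L g / algebraMap R L x ^ m ↔ _
  rw [div_eq_div_iff (pow_ne_zero _ hxL) (pow_ne_zero _ hxL), ← map_pow, ← map_pow, ← map_mul,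
    ← map_mul, (IsFractionRing.injective R L).eq_iff]

theorem dicriticalPrime_le_of_forall (V : dicriticalDivisors L I) {P : Ideal (reesAlgebra I)}
    (h : ∀ {n : ℕ} {f : R} (hf : f ∈ I ^ n), reesMonomial hf ∈ dicriticalPrime V →
      reesMonomial hf ∈ P) : dicriticalPrime V ≤ P := by
  intro f hf
  rw [← sum_reesMonomial f]
  exact sum_mem fun n _ => h _ ((mem_dicriticalPrime_iff_reesMonomial V f).1 hf n)

omit [IsLocalRing R] [IsNoetherianRing R] in
theorem ne_zero_of_reesDegreeOne_notMem {P : Ideal (reesAlgebra I)} {x : I}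
    (h : reesDegreeOne x ∉ P) : (x : R) ≠ 0 := by
  intro h0
  refine h ?_
  have : reesDegreeOne x = 0 := (reesDegreeOneLinear I).map_zero ▸
    congrArg reesDegreeOne (Subtype.ext h0 : x = 0)
  rw [this]
  exact zero_mem _

variable (hrad : I.radical = IsLocalRing.maximalIdeal R) (hI : IsNormalIdeal L I)

section Normal

variable [IsDomain R] [IsIntegrallyClosed R]

include hrad hI

theorem map_maximalIdeal_le_dicriticalPrime (V : dicriticalDivisors L I) :
    (IsLocalRing.maximalIdeal R).map (algebraMap R (reesAlgebra I)) ≤ dicriticalPrime V := by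
  rw [Ideal.map_le_iff_le_comap]
  intro r hr
  obtain ⟨x, Q, h⟩ := exists_isChart hrad hI V
  have := ((range_le_toLocalSubring_iff V.1).1 (range_le_of_isChart hrad h)).2 r hr
  rw [Ideal.mem_comap, algebraMap_eq_reesMonomial, reesMonomial_mem_dicriticalPrime_iff]
  simpa [value] using this

theorem dicriticalPrime_mem_minimalPrimes (V : dicriticalDivisors L I) : dicriticalPrime V ∈
    ((IsLocalRing.maximalIdeal R).map (algebraMap R (reesAlgebra I))).minimalPrimes := by
  obtain ⟨x, Q, h⟩ := exists_isChart hrad hI V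
  refine ⟨⟨isPrime_dicriticalPrime V, map_maximalIdeal_le_dicriticalPrime hrad hI V⟩,
    fun P' hP' hle => h.mem_minimalPrimes_span.2 ⟨hP'.1, ?_⟩ hle⟩
  rw [Ideal.span_singleton_le_iff_mem]
  exact hP'.2 (Ideal.mem_map_of_mem _ (le_maximalIdeal_of_radical_eq hrad h.mem))

/-- No minimal prime of `M E` contains all `y Z`, since these and `M E` generate an ideal which
properly contains the prime of any dicritical divisor. -/
theorem exists_reesDegreeOne_notMem_of_mem_minimalPrimes (hI0 : I ≠ ⊥) {P : Ideal (reesAlgebra I)}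
    (hP : P ∈ ((IsLocalRing.maximalIdeal R).map (algebraMap R (reesAlgebra I))).minimalPrimes) :
    ∃ y : I, reesDegreeOne y ∉ P := by
  by_contra! hU
  obtain ⟨V⟩ := nonempty_dicriticalDivisors hrad hI hI0
  have hV : ∀ r : R, algebraMap R L r ∈ V.1 := algebraMap_mem_of_mem_dicriticalDivisors V.2
  obtain ⟨x, Q, h⟩ := exists_isChart hrad hI V
  refine h.reesDegreeOne_notMem (hP.2 ⟨isPrime_dicriticalPrime V,
    map_maximalIdeal_le_dicriticalPrime hrad hI V⟩ (fun f hf => ?_) (hU ⟨x, h.mem⟩))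
  refine mem_of_forall_reesDegreeOne_mem hP.1.2 hU ?_
  have h0 := (mem_dicriticalPrime_iff V f).1 hf 0
  rw [pow_zero, mul_one] at h0
  by_contra hu
  obtain ⟨b, hb⟩ := isUnit_iff_exists_inv.1 (by simpa using hu : IsUnit ((f : R[X]).coeff 0))
  have h1 : value V.1 ((f : R[X]).coeff 0) * value V.1 b < 1 :=
    mul_lt_one_of_lt_of_le h0 ((V.1.valuation_le_one_iff _).2 (hV b))
  rw [value, value, ← map_mul, ← map_mul, hb, map_one, map_one] at h1
  exact lt_irrefl _ h1

/-- A prime `P ⊇ M E` not containing `x Z` contains the prime of a dicritical divisor: the elements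
`f / xⁿ` of the chart of `x` with `f Zⁿ ∉ P` form a multiplicative set which does not meet the ideal
generated by `x`. -/
theorem exists_dicriticalPrime_le {P : Ideal (reesAlgebra I)} [hPp : P.IsPrime]
    (hM : (IsLocalRing.maximalIdeal R).map (algebraMap R (reesAlgebra I)) ≤ P) {x : I}
    (hxP : reesDegreeOne x ∉ P) : ∃ V : dicriticalDivisors L I, dicriticalPrime V ≤ P := by
  obtain ⟨x, hx⟩ := x
  have hx0 : x ≠ 0 := ne_zero_of_reesDegreeOne_notMem hxP
  have hx1 : x ∈ I ^ 1 := (pow_one I).symm ▸ hx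
  have hx00 : x ∈ I ^ 0 := by simp
  have hxn : ∀ n, reesMonomial hx1 ^ n ∉ P := fun n h => hxP (hPp.mem_of_pow_mem n h)
  have key : ∀ {n m : ℕ} {f g : R} (hf : f ∈ I ^ n) (hg : g ∈ I ^ m), f * x ^ m = g * x ^ n →
      reesMonomial hf * reesMonomial hx1 ^ m = reesMonomial hg * reesMonomial hx1 ^ n := by
    intro n m f g hf hg h
    simp only [reesMonomial_pow, reesMonomial_mul]
    exact reesMonomial_congr (by ring) h
  let S : Submonoid (blowupChart L I x) :=
    { carrier := {a | ∃ (n : ℕ) (f : R) (hf : f ∈ I ^ n), a = chartElem hx hx0 hf ∧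
        reesMonomial hf ∉ P}
      one_mem' := by
        refine ⟨0, 1, by simp, Subtype.ext (by simp [chartElem]), fun h => ?_⟩
        rw [← algebraMap_eq_reesMonomial, map_one] at h
        exact hPp.ne_top ((Ideal.eq_top_iff_one P).2 h)
      mul_mem' := by
        rintro _ _ ⟨n, f, hf, rfl, hfP⟩ ⟨m, g, hg, rfl, hgP⟩
        refine ⟨n + m, f * g, mul_mem_ideal_pow hf hg, chartElem_mul hx hx0 hf hg, ?_⟩
        rw [← reesMonomial_mul hf hg]
        exact fun h => (hPp.mem_or_mem h).elim hfP hgP }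
  have hdisj : Disjoint ((Ideal.span {algebraMap R (blowupChart L I x) x} :
      Ideal (blowupChart L I x)) : Set (blowupChart L I x)) S := by
    rw [Set.disjoint_left]
    rintro a ha ⟨n, f, hf, rfl, hfP⟩
    obtain ⟨c, hc⟩ := Ideal.mem_span_singleton'.1 ha
    obtain ⟨m, g, hg, rfl⟩ := exists_chartElem_eq hx hx0 c
    have hxc : algebraMap R (blowupChart L I x) x =
        chartElem hx hx0 (n := 0) (f := x) (by simp) :=
      Subtype.ext (by simp [chartElem, coe_algebraMap_blowupChart])
    rw [hxc, chartElem_mul, chartElem_eq_iff] at hc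
    have h1 := key (mul_mem_ideal_pow hg hx00) hf hc
    have h2 : reesMonomial (mul_mem_ideal_pow hg hx00) ∈ P := by
      rw [← reesMonomial_mul hg hx00, ← algebraMap_eq_reesMonomial]
      exact P.mul_mem_left _ (hM (Ideal.mem_map_of_mem _ (le_maximalIdeal_of_radical_eq hrad hx)))
    have h3 : reesMonomial hf * reesMonomial hx1 ^ (m + 0) ∈ P := by
      rw [← h1]
      exact P.mul_mem_right _ h2
    exact (hPp.mem_or_mem h3).elim hfP (hxn _)
  obtain ⟨Q', hQ', hle', hdisj'⟩ := Ideal.exists_le_prime_disjoint _ S hdisj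
  obtain ⟨Q, hQ, hle⟩ := Ideal.exists_minimalPrimes_le hle'
  obtain ⟨V, h⟩ := exists_isChart_of_mem_minimalPrimes hrad hI hx hx0 hQ
  refine ⟨V, dicriticalPrime_le_of_forall V fun {n f} hf hfV => ?_⟩
  by_contra hfP
  exact Set.disjoint_left.1 hdisj' (hle ((h.chartElem_mem_iff hf).2 hfV)) ⟨n, f, hf, rfl, hfP⟩

theorem range_dicriticalPrime (hI0 : I ≠ ⊥) :
    Set.range (dicriticalPrime : dicriticalDivisors L I → Ideal (reesAlgebra I)) =
      ((IsLocalRing.maximalIdeal R).map (algebraMap R (reesAlgebra I))).minimalPrimes := by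
  refine Set.Subset.antisymm ?_ fun P hP => ?_
  · rintro _ ⟨V, rfl⟩
    exact dicriticalPrime_mem_minimalPrimes hrad hI V
  · obtain ⟨x, hx⟩ := exists_reesDegreeOne_notMem_of_mem_minimalPrimes hrad hI hI0 hP
    have := hP.1.1
    obtain ⟨V, hV⟩ := exists_dicriticalPrime_le hrad hI hP.1.2 hx
    exact ⟨V, le_antisymm hV (hP.2 ⟨isPrime_dicriticalPrime V,
      map_maximalIdeal_le_dicriticalPrime hrad hI V⟩ hV)⟩

/-- `V` can be recovered from `P*`: it consists of the fractions `f / g` with `f, g ∈ Iⁿ` and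
`g Zⁿ ∉ P*`. -/
theorem le_of_dicriticalPrime_eq (hI0 : I ≠ ⊥) {V V' : dicriticalDivisors L I}
    (hVV' : dicriticalPrime V = dicriticalPrime V') : V.1 ≤ V'.1 := by
  have hV' : ∀ r : R, algebraMap R L r ∈ V'.1 := algebraMap_mem_of_mem_dicriticalDivisors V'.2
  obtain ⟨x, Q, h⟩ := exists_isChart hrad hI V
  have hQ := h.minimal.1.1
  have hx : value V'.1 x = idealValue V'.1 I :=
    (value_eq_idealValue_iff hI0 V' ⟨x, h.mem⟩).2 (hVV' ▸ h.reesDegreeOne_notMem)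
  have key : ∀ {n : ℕ} {f : R} (hf : f ∈ I ^ n),
      V'.1.valuation (chartElem h.mem h.ne_zero hf : blowupChart L I x) =
        value V'.1 f * (idealWeight V'.1 I : V'.1.ValueGroup) ^ n := by
    intro n f hf
    change V'.1.valuation (algebraMap R L f / algebraMap R L x ^ n) = _
    rw [coe_idealWeight V'.1 hV' hI0, ← hx, map_div₀, map_pow, div_eq_mul_inv, inv_pow]
    rfl
  intro z hz
  have hz' : z ∈ (LocalSubring.ofPrime (blowupChart L I x) Q).toSubring := by
    rw [← h.eq]; exact hz
  obtain ⟨a, b, hb, rfl⟩ := (mem_ofPrime _ Q).1 hz'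
  obtain ⟨n, f, hf, rfl⟩ := exists_chartElem_eq h.mem h.ne_zero a
  obtain ⟨m, g, hg, rfl⟩ := exists_chartElem_eq h.mem h.ne_zero b
  rw [h.chartElem_mem_iff, hVV', reesMonomial_mem_dicriticalPrime_iff, ← key hg, not_lt] at hb
  rw [← V'.1.valuation_le_one_iff, map_div₀]
  refine div_le_one_of_le₀ (le_trans ?_ hb) zero_le
  rw [key hf]
  exact value_mul_idealWeight_pow_le_one V'.1 hV' I n f hf

theorem injective_dicriticalPrime (hI0 : I ≠ ⊥) : Function.Injective
    (dicriticalPrime : dicriticalDivisors L I → Ideal (reesAlgebra I)) := fun _ _ h =>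
  Subtype.ext (le_antisymm (le_of_dicriticalPrime_eq hrad hI hI0 h)
    (le_of_dicriticalPrime_eq hrad hI hI0 h.symm))

theorem finite_dicriticalDivisors (hI0 : I ≠ ⊥) : Finite (dicriticalDivisors L I) := by
  have : Finite (Set.range
      (dicriticalPrime : dicriticalDivisors L I → Ideal (reesAlgebra I))) := by
    rw [range_dicriticalPrime hrad hI hI0]
    exact Ideal.finite_minimalPrimes_of_isNoetherianRing _ _
  exact Finite.of_injective_finite_range (injective_dicriticalPrime hrad hI hI0)

theorem finite_dicriticalSet (hI0 : I ≠ ⊥) : (dicriticalSet L I).Finite := by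
  have := finite_dicriticalDivisors hrad hI hI0
  refine ((Set.toFinite (dicriticalDivisors L I)).image
    ValuationSubring.toLocalSubring).subset fun T hT => ?_
  obtain ⟨_, V, x, Q, rfl, h⟩ := exists_isChart_of_mem_dicriticalSet hrad hI hT
  exact ⟨V, hT, rfl⟩

theorem height_dicriticalPrime (V : dicriticalDivisors L I) : (dicriticalPrime V).height = 1 := by
  obtain ⟨x, Q, h⟩ := exists_isChart hrad hI V
  have := isPrime_dicriticalPrime V
  have hx0 : algebraMap R (reesAlgebra I) x ≠ 0 := fun h0 => h.ne_zero (by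
    have := congrArg (fun f : reesAlgebra I => (f : R[X]).coeff 0) h0
    simpa using this)
  exact le_antisymm
    (Ideal.height_le_one_of_isPrincipal_of_mem_minimalPrimes _ _ h.mem_minimalPrimes_span)
    ((Ideal.one_le_height_span_singleton_of_mem_nonZeroDivisors
      (mem_nonZeroDivisors_iff_ne_zero.2 hx0)).trans
        (Ideal.height_mono h.mem_minimalPrimes_span.1.2))

end Normal

end MinimalPrimes

/-! ### The dimension of the Rees ring -/

section ReesDimension

variable {R : Type u} [CommRing R] {I : Ideal R}

theorem reesMonomial_mem_of_reesDegreeOne_mem {S : Subalgebra R (reesAlgebra I)}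
    (hS : ∀ y : I, reesDegreeOne y ∈ S) (n : ℕ) {a : R} (ha : a ∈ I ^ n) : reesMonomial ha ∈ S := by
  induction n generalizing a with
  | zero => exact S.algebraMap_mem a
  | succ n ih =>
    have hle : I ^ n * I ≤ I ^ (n + 1) := (pow_succ I n).ge
    suffices h : ∃ h : a ∈ I ^ (n + 1), reesMonomial h ∈ S from h.2
    refine Submodule.mul_induction_on (C := fun a => ∃ h : a ∈ I ^ (n + 1), reesMonomial h ∈ S)
      ((pow_succ I n).le ha) (fun x hx y hy => ⟨hle (Ideal.mul_mem_mul hx hy), ?_⟩) ?_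
    · have h := mul_mem (ih hx) (hS ⟨y, hy⟩)
      rw [reesDegreeOne_eq, reesMonomial_mul] at h
      exact h
    · rintro x y ⟨hx, hx'⟩ ⟨hy, hy'⟩
      exact ⟨add_mem hx hy, reesMonomial_add hx hy ▸ add_mem hx' hy'⟩

theorem eq_top_of_reesDegreeOne_mem {S : Subalgebra R (reesAlgebra I)}
    (hS : ∀ y : I, reesDegreeOne y ∈ S) : S = ⊤ := by
  refine eq_top_iff.2 fun f _ => ?_
  rw [← sum_reesMonomial f]
  exact sum_mem fun n _ => reesMonomial_mem_of_reesDegreeOne_mem hS n _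

theorem adjoin_reesDegreeOne {s : Set I} (hs : Submodule.span R s = ⊤) :
    Algebra.adjoin R (reesDegreeOne '' s) = ⊤ := by
  refine eq_top_of_reesDegreeOne_mem fun y => ?_
  have h : (reesDegreeOneLinear I) y ∈ Submodule.span R (reesDegreeOneLinear I '' s) := by
    rw [← Submodule.map_span, hs]
    exact Submodule.mem_map_of_mem trivial
  exact Algebra.span_le_adjoin R _ h

/-- The Rees ring is generated over `R` by elements `y Z`, each of which lies in the quotient field
of `R[y₁ Z]` for a fixed `y₁ ≠ 0`; the latter has dimension at most `d + 1`. -/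
theorem ringKrullDim_reesAlgebra_le [IsDomain R] [IsNoetherianRing R] {d : ℕ}
    (hd : ringKrullDim R = d) (hI0 : I ≠ ⊥) : ringKrullDim (reesAlgebra I) ≤ (d + 1 : ℕ) := by
  obtain ⟨y₁, hy₁, hy₁0⟩ := Submodule.exists_mem_ne_zero_of_ne_bot hI0
  obtain ⟨t, ht⟩ := (inferInstance : Module.Finite R I).1
  have key : ∀ t : Finset I, ringKrullDim (Algebra.adjoin R
      (insert (reesDegreeOne ⟨y₁, hy₁⟩) (reesDegreeOne '' (t : Set I)))) ≤ (d + 1 : ℕ) := by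
    classical
    intro t
    induction t using Finset.induction_on with
    | empty =>
      rw [Finset.coe_empty, Set.image_empty, insert_empty_eq,
        Algebra.adjoin_singleton_eq_range_aeval]
      refine (ringKrullDim_le_of_surjective (aeval (reesDegreeOne ⟨y₁, hy₁⟩)).rangeRestrict.toRingHom
        (AlgHom.rangeRestrict_surjective _)).trans ?_
      rw [Polynomial.ringKrullDim_of_isNoetherianRing, hd]
      push_cast
      exact le_rfl
    | insert y t _ ih =>
      rw [Finset.coe_insert, Set.image_insert_eq, Set.insert_comm]
      refine ringKrullDim_adjoin_insert_le _ ((t.finite_toSet.image _).insert _) ih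
        (b := algebraMap R _ y₁) (c := algebraMap R _ (y : R) * reesDegreeOne ⟨y₁, hy₁⟩)
        (Subalgebra.algebraMap_mem _ _) (mul_mem (Subalgebra.algebraMap_mem _ _)
          (Algebra.subset_adjoin (Set.mem_insert _ _))) ?_ ?_
      · intro h
        have := congrArg (fun f : reesAlgebra I => (f : R[X]).coeff 0) h
        exact hy₁0 (by simpa using this)
      · rw [← Algebra.smul_def, ← Algebra.smul_def]
        change y₁ • reesDegreeOneLinear I y = (y : R) • reesDegreeOneLinear I ⟨y₁, hy₁⟩
        rw [← map_smul, ← map_smul]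
        exact congrArg _ (Subtype.ext (mul_comm _ _))
  have htop : Algebra.adjoin R
      (insert (reesDegreeOne ⟨y₁, hy₁⟩) (reesDegreeOne '' (t : Set I))) = ⊤ :=
    eq_top_iff.2 ((adjoin_reesDegreeOne ht).ge.trans (Algebra.adjoin_mono (Set.subset_insert _ _)))
  have h := key t
  rw [htop, ringKrullDim_eq_of_ringEquiv Subalgebra.topEquiv.toRingEquiv] at h
  exact h

theorem WithBot.le_of_le_of_ne {a : WithBot ℕ∞} {n : ℕ} (h : a ≤ (n : WithBot ℕ∞)) (hne : a ≠ n) :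
    a ≤ (n - 1 : ℕ) := by
  induction a with
  | bot => exact bot_le
  | coe a =>
    induction a with
    | top =>
      have : (⊤ : ℕ∞) ≤ n := WithBot.coe_le_coe.1 h
      simp at this
    | coe a =>
      have h1 : a ≤ n := by exact_mod_cast h
      have h2 : a ≠ n := by exact_mod_cast hne
      exact WithBot.coe_le_coe.2 (Nat.cast_le.2 (by omega))

theorem one_le_of_ringKrullDim_eq [IsDomain R] [IsLocalRing R] {d : ℕ} (hd : ringKrullDim R = d)
    (hrad : I.radical = IsLocalRing.maximalIdeal R) (hI0 : I ≠ ⊥) : 1 ≤ d := by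
  by_contra hd0
  obtain rfl : d = 0 := by omega
  have : Ring.KrullDimLE 0 R := Ring.krullDimLE_iff.2 (by simp [hd])
  have hM := IsLocalRing.isField_iff_maximalIdeal_eq.1 (Ring.KrullDimLE.isField_of_isDomain (R := R))
  exact hI0 (le_bot_iff.1 (hM ▸ hrad ▸ Ideal.le_radical))

end ReesDimension

/-! ### Reductions from homogeneous parameters -/

section Parameters

variable {R : Type u} [CommRing R] [IsLocalRing R] [IsNoetherianRing R] {I : Ideal R}

/-- If the minimal primes of `M E + (T)` other than those containing the irrelevant ideal have
dimension at most `m`, then `m` elements of `A` together with `M E + (T)` generate an ideal whose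
radical contains the irrelevant ideal. Here `A` is a set of homogeneous elements which is large
enough for prime avoidance. -/
theorem exists_parameters_reesAlgebra {A : Set (reesAlgebra I)}
    (hA : ∀ 𝒮 : Set (Ideal (reesAlgebra I)), 𝒮.Finite →
      (∀ P ∈ 𝒮, P.IsPrime ∧ (IsLocalRing.maximalIdeal R).map (algebraMap R (reesAlgebra I)) ≤ P ∧
        ¬ Set.range reesDegreeOne ⊆ (P : Set (reesAlgebra I))) → ∃ a ∈ A, ∀ P ∈ 𝒮, a ∉ P)
    (hAhom : ∀ a ∈ A, SetLike.IsHomogeneousElem (reesGrading I) a) {T : Set (reesAlgebra I)}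
    (hT : ∀ a ∈ T, SetLike.IsHomogeneousElem (reesGrading I) a) (m : ℕ)
    (hm : ∀ P ∈ ((IsLocalRing.maximalIdeal R).map (algebraMap R (reesAlgebra I)) ⊔
      Ideal.span T).minimalPrimes, ¬ Set.range reesDegreeOne ⊆ (P : Set (reesAlgebra I)) →
        ringKrullDim (reesAlgebra I ⧸ P) ≤ m) :
    ∃ a : Fin m → reesAlgebra I, (∀ i, a i ∈ A) ∧ ∀ y : I, reesDegreeOne y ∈
      ((IsLocalRing.maximalIdeal R).map (algebraMap R (reesAlgebra I)) ⊔
        Ideal.span (T ∪ Set.range a)).radical := by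
  obtain ⟨a, haA, ha⟩ := exists_parameters _ _ A hA m _ le_sup_left hm
  refine ⟨a, haA, fun y => ?_⟩
  rw [Ideal.span_union, ← sup_assoc, ← Ideal.sInf_minimalPrimes, Ideal.mem_sInf]
  intro P hP
  by_cases hU : Set.range reesDegreeOne ⊆ (P : Set (reesAlgebra I))
  · exact hU ⟨y, rfl⟩
  refine reesDegreeOne_mem_of_ringKrullDim_le_zero (.sup (.sup ?_ ?_) ?_) hP (ha P hP hU) y
  · refine Ideal.homogeneous_span _ _ ?_
    rintro _ ⟨r, _, rfl⟩
    exact ⟨0, algebraMap_eq_reesMonomial (I := I) r ▸ reesMonomial_mem_reesGrading _⟩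
  · exact Ideal.homogeneous_span _ _ hT
  · refine Ideal.homogeneous_span _ _ ?_
    rintro _ ⟨i, rfl⟩
    exact hAhom _ (haA i)

theorem isReduction_span_of_radical {n : ℕ} (hn : 1 ≤ n) {S : Set R} (hS : S ⊆ (I ^ n : Ideal R))
    {G : Set (reesAlgebra I)}
    (hG : ∀ g ∈ G, ∃ k : ℕ, ∃ a ∈ S, ∃ ha : a ∈ I ^ n, g ^ k = reesMonomial ha)
    (h : ∀ y : I, reesDegreeOne y ∈ ((IsLocalRing.maximalIdeal R).map
      (algebraMap R (reesAlgebra I)) ⊔ Ideal.span G).radical) :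
    IsReduction (Ideal.span S) (I ^ n) := by
  refine isReduction_of_le_radical hn hS le_rfl fun y => ?_
  refine Ideal.radical_le_radical_iff.2 (sup_le (le_sup_left.trans Ideal.le_radical) ?_) (h y)
  rw [Ideal.span_le]
  intro g hg
  obtain ⟨k, a, haS, ha, hk⟩ := hG g hg
  refine ⟨k, ?_⟩
  rw [hk]
  exact Ideal.mem_sup_right (Ideal.subset_span ⟨a, haS, ha, rfl⟩)

variable (I) in
/-- The monomials `a Zⁿ` of positive degree. -/
def positiveMonomials : Set (reesAlgebra I) :=
  {f | ∃ n, 1 ≤ n ∧ ∃ (a : R) (ha : a ∈ I ^ n), f = reesMonomial ha}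

omit [IsLocalRing R] [IsNoetherianRing R] in
theorem exists_positiveMonomials_notMem {𝒮 : Set (Ideal (reesAlgebra I))} (h𝒮 : 𝒮.Finite)
    (h : ∀ P ∈ 𝒮, P.IsPrime ∧ ¬ Set.range reesDegreeOne ⊆ (P : Set (reesAlgebra I))) :
    ∃ a ∈ positiveMonomials I, ∀ P ∈ 𝒮, a ∉ P := by
  obtain ⟨n, hn, a, ha, hP⟩ := exists_reesMonomial_notMem _ h𝒮.toFinset le_rfl fun P hP => by
    obtain ⟨hp, hU⟩ := h P (h𝒮.mem_toFinset.1 hP)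
    simp only [Set.subset_def, Set.mem_range, not_forall] at hU
    obtain ⟨_, ⟨y, rfl⟩, hy⟩ := hU
    exact ⟨hp, y, hy⟩
  exact ⟨_, ⟨n, hn, a, ha, rfl⟩, fun P hPS => hP P (h𝒮.mem_toFinset.2 hPS)⟩

omit [IsLocalRing R] [IsNoetherianRing R] in
theorem isHomogeneousElem_of_mem_positiveMonomials {f : reesAlgebra I}
    (hf : f ∈ positiveMonomials I) : SetLike.IsHomogeneousElem (reesGrading I) f := by
  obtain ⟨n, _, a, ha, rfl⟩ := hf
  exact ⟨n, reesMonomial_mem_reesGrading ha⟩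

/-- The homogeneous parameters have different degrees `nᵢ`; their powers of exponents
`r s / nᵢ` with `s = ∏ nᵢ` have the common degree `r s`. -/
theorem exists_isReduction {r : ℕ} (hr : 1 ≤ r) {T : Set R} (hT : T ⊆ (I ^ r : Ideal R)) (m : ℕ)
    (hm : ∀ P ∈ ((IsLocalRing.maximalIdeal R).map (algebraMap R (reesAlgebra I)) ⊔
      Ideal.span {f | ∃ a ∈ T, ∃ ha : a ∈ I ^ r, f = reesMonomial ha}).minimalPrimes,
        ¬ Set.range reesDegreeOne ⊆ (P : Set (reesAlgebra I)) →
          ringKrullDim (reesAlgebra I ⧸ P) ≤ m) :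
    ∃ s : ℕ, 1 ≤ s ∧ ∃ y : Fin m → R, (∀ i, y i ∈ I ^ (r * s)) ∧ ∀ t : ℕ, 1 ≤ t →
      IsReduction (Ideal.span ((fun a => a ^ (s * t)) '' T ∪ Set.range fun i => y i ^ t))
        (I ^ (r * s * t)) := by
  obtain ⟨a, haA, ha⟩ := exists_parameters_reesAlgebra (A := positiveMonomials I)
    (fun 𝒮 h𝒮 h => exists_positiveMonomials_notMem h𝒮 fun P hP => ⟨(h P hP).1, (h P hP).2.2⟩)
    (fun _ => isHomogeneousElem_of_mem_positiveMonomials) (T := {f | ∃ a ∈ T, ∃ ha : a ∈ I ^ r,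
      f = reesMonomial ha}) (by
        rintro _ ⟨a, _, ha, rfl⟩
        exact ⟨r, reesMonomial_mem_reesGrading ha⟩) m hm
  choose n hn b hb hab using haA
  have hdvd : ∀ i, n i ∣ ∏ j, n j := fun i => Finset.dvd_prod_of_mem n (Finset.mem_univ i)
  have hs : 1 ≤ ∏ j, n j := Finset.one_le_prod' fun j _ => hn j
  set s := ∏ j, n j
  have he : ∀ i, n i * (r * (s / n i)) = r * s := fun i => by
    rw [mul_left_comm, Nat.mul_div_cancel' (hdvd i)]
  have hbI : ∀ i, b i ^ (r * (s / n i)) ∈ I ^ (r * s) := fun i =>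
    he i ▸ pow_mem_ideal_pow (hb i) (r * (s / n i))
  have hyI : ∀ i (t : ℕ), (b i ^ (r * (s / n i))) ^ t ∈ I ^ (r * s * t) := fun i t =>
    pow_mem_ideal_pow (hbI i) t
  have hTI : ∀ x ∈ T, ∀ t : ℕ, x ^ (s * t) ∈ I ^ (r * s * t) := fun x hx t =>
    mul_assoc r s t ▸ pow_mem_ideal_pow (hT hx) (s * t)
  refine ⟨s, hs, fun i => b i ^ (r * (s / n i)), hbI, fun t ht => ?_⟩
  refine isReduction_span_of_radical (Nat.mul_pos (Nat.mul_pos hr hs) ht) ?_ ?_ ha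
  · rintro _ (⟨x, hx, rfl⟩ | ⟨i, rfl⟩)
    · exact hTI x hx t
    · exact hyI i t
  · rintro _ (⟨x, hx, hxI, rfl⟩ | ⟨i, rfl⟩)
    · refine ⟨s * t, _, Or.inl ⟨x, hx, rfl⟩, hTI x hx t, ?_⟩
      rw [reesMonomial_pow]
      exact reesMonomial_congr (mul_assoc r s t).symm rfl
    · refine ⟨r * (s / n i) * t, _, Or.inr ⟨i, rfl⟩, hyI i t, ?_⟩
      rw [hab, reesMonomial_pow]
      refine reesMonomial_congr ?_ (pow_mul _ _ _)
      rw [← mul_assoc, he]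

/-- If the residue field is infinite, the parameters can be chosen in degree one. -/
theorem exists_isReduction_of_infinite [Infinite (IsLocalRing.ResidueField R)] {T : Set R}
    (hT : T ⊆ I) (m : ℕ)
    (hm : ∀ P ∈ ((IsLocalRing.maximalIdeal R).map (algebraMap R (reesAlgebra I)) ⊔
      Ideal.span {f | ∃ a ∈ T, ∃ ha : a ∈ I ^ 1, f = reesMonomial ha}).minimalPrimes,
        ¬ Set.range reesDegreeOne ⊆ (P : Set (reesAlgebra I)) →
          ringKrullDim (reesAlgebra I ⧸ P) ≤ m) :
    ∃ y : Fin m → R, (∀ i, y i ∈ I) ∧ IsReduction (Ideal.span (T ∪ Set.range y)) I := by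
  obtain ⟨a, haA, ha⟩ := exists_parameters_reesAlgebra (A := Set.range (reesDegreeOne (I := I)))
    (fun 𝒮 h𝒮 h => by
      obtain ⟨x, hx⟩ := exists_reesDegreeOne_notMem h𝒮.toFinset fun P hP => by
        obtain ⟨_, hM, hU⟩ := h P (h𝒮.mem_toFinset.1 hP)
        simp only [Set.subset_def, Set.mem_range, not_forall] at hU
        obtain ⟨_, ⟨y, rfl⟩, hy⟩ := hU
        exact ⟨hM, y, hy⟩
      exact ⟨_, ⟨x, rfl⟩, fun P hP => hx P (h𝒮.mem_toFinset.2 hP)⟩)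
    (by
      rintro _ ⟨x, rfl⟩
      exact ⟨1, reesDegreeOne_eq x ▸ reesMonomial_mem_reesGrading _⟩)
    (T := {f | ∃ a ∈ T, ∃ ha : a ∈ I ^ 1, f = reesMonomial ha}) (by
        rintro _ ⟨a, _, ha, rfl⟩
        exact ⟨1, reesMonomial_mem_reesGrading ha⟩) m hm
  choose b hb using haA
  refine ⟨fun i => b i, fun i => (b i).2, ?_⟩
  suffices h : IsReduction (Ideal.span (T ∪ Set.range fun i => (b i : R))) (I ^ 1) by
    rwa [congrArg (IsReduction _) (pow_one I)] at h
  refine isReduction_span_of_radical le_rfl ?_ ?_ ha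
  · rintro _ (hx | ⟨i, rfl⟩)
    · exact (pow_one I).symm ▸ hT hx
    · exact (pow_one I).symm ▸ (b i).2
  · rintro _ (⟨x, hx, hxI, rfl⟩ | ⟨i, rfl⟩)
    · exact ⟨1, x, Or.inl hx, hxI, pow_one _⟩
    · exact ⟨1, b i, Or.inr ⟨i, rfl⟩, (pow_one I).symm ▸ (b i).2, by rw [pow_one, ← hb]; rfl⟩

theorem isReduction_of_ringKrullDim_le_zero {T : Set R} (hT : T ⊆ I)
    (hm : ∀ P ∈ ((IsLocalRing.maximalIdeal R).map (algebraMap R (reesAlgebra I)) ⊔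
      Ideal.span {f | ∃ a ∈ T, ∃ ha : a ∈ I ^ 1, f = reesMonomial ha}).minimalPrimes,
        ringKrullDim (reesAlgebra I ⧸ P) ≤ (0 : ℕ)) : IsReduction (Ideal.span T) I := by
  obtain ⟨a, -, ha⟩ := exists_parameters_reesAlgebra (A := positiveMonomials I)
    (fun 𝒮 h𝒮 h => exists_positiveMonomials_notMem h𝒮 fun P hP => ⟨(h P hP).1, (h P hP).2.2⟩)
    (fun _ => isHomogeneousElem_of_mem_positiveMonomials) (T := {f | ∃ a ∈ T, ∃ ha : a ∈ I ^ 1,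
      f = reesMonomial ha}) (by
        rintro _ ⟨a, _, ha, rfl⟩
        exact ⟨1, reesMonomial_mem_reesGrading ha⟩) 0 fun P hP _ => hm P hP
  rw [Set.range_eq_empty, Set.union_empty] at ha
  suffices h : IsReduction (Ideal.span T) (I ^ 1) by
    rwa [congrArg (IsReduction _) (pow_one I)] at h
  refine isReduction_span_of_radical le_rfl (fun x hx => (pow_one I).symm ▸ hT hx) ?_ ha
  rintro _ ⟨x, hx, hxI, rfl⟩
  exact ⟨1, x, hx, hxI, pow_one _⟩

end Parameters

/-! ### Dimensions of the residue rings at the dicritical primes -/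

/-- If an `R`-algebra `E` is generated by elements `g y` integral over the subalgebra generated by
`s`, then a quotient of `E` is integral over every subring `D` containing the images of `R` and
`s`. -/
theorem isIntegral_subtype_of_isIntegral_adjoin {R E B ι : Type*} [CommRing R] [CommRing E]
    [CommRing B] [Algebra R E] (π : E →+* B) (hπ : Function.Surjective π) (D : Subring B)
    (hR : ∀ r : R, π (algebraMap R E r) ∈ D) {s : Set E} (hs : ∀ a ∈ s, π a ∈ D) {g : ι → E}
    (hg : ∀ S : Subalgebra R E, (∀ y, g y ∈ S) → S = ⊤)
    (hint : ∀ y, IsIntegral (Algebra.adjoin R s) (g y)) : D.subtype.IsIntegral := by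
  have hCD : ∀ c : Algebra.adjoin R s, π (c : E) ∈ D := by
    rintro ⟨c, hc⟩
    induction hc using Algebra.adjoin_induction with
    | mem c hc => exact hs c hc
    | algebraMap r => exact hR r
    | add a b _ _ ha hb => rw [map_add]; exact add_mem ha hb
    | mul a b _ _ ha hb => rw [map_mul]; exact mul_mem ha hb
  let ψ : Algebra.adjoin R s →+* D :=
    (π.comp (Algebra.adjoin R s).val.toRingHom).codRestrict D hCD
  let S : Subalgebra R E :=
    { (integralClosure D B).toSubring.comap π with
      algebraMap_mem' := fun r => isIntegral_algebraMap (R := D) (A := B) (x := ⟨_, hR r⟩) }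
  have hS : S = ⊤ := hg S fun y => (hint y).map_of_comp_eq ψ π rfl
  intro b
  obtain ⟨b, rfl⟩ := hπ b
  have : b ∈ S := hS ▸ trivial
  exact this

/-- In the situation of the preceding lemma, a quotient in which the maximal ideal of `R` and one of
`d` elements become zero is integral over an algebra generated by `d - 1` elements over a field. -/
theorem ringKrullDim_le_of_isIntegral_adjoin {R E B ι : Type*} [CommRing R] [IsLocalRing R]
    [CommRing E] [CommRing B] [Algebra R E] (π : E →+* B) (hπ : Function.Surjective π)
    (hM : ∀ r ∈ IsLocalRing.maximalIdeal R, π (algebraMap R E r) = 0) {g : ι → E}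
    (hg : ∀ S : Subalgebra R E, (∀ y, g y ∈ S) → S = ⊤) {d : ℕ} {x : Fin d → E}
    (hint : ∀ y, IsIntegral (Algebra.adjoin R (Set.range x)) (g y)) {i₀ : Fin d}
    (hi₀ : π (x i₀) = 0) : ringKrullDim B ≤ (d - 1 : ℕ) := by
  let κ : R ⧸ IsLocalRing.maximalIdeal R →+* B :=
    Ideal.Quotient.lift _ (π.comp (algebraMap R E)) hM
  let φ : MvPolynomial {i : Fin d // i ≠ i₀} (R ⧸ IsLocalRing.maximalIdeal R) →+* B :=
    MvPolynomial.eval₂Hom κ fun i => π (x i.1)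
  have hR : ∀ r : R, π (algebraMap R _ r) ∈ φ.range := fun r =>
    ⟨MvPolynomial.C (Ideal.Quotient.mk _ r), by simp [φ, κ]⟩
  have hxD : ∀ i, π (x i) ∈ φ.range := fun i => by
    by_cases hi : i = i₀
    · rw [hi, hi₀]
      exact zero_mem _
    · exact ⟨MvPolynomial.X ⟨i, hi⟩, by simp [φ]⟩
  refine (ringKrullDim_le_of_isIntegral φ.range.subtype
    (isIntegral_subtype_of_isIntegral_adjoin π hπ _ hR
      (by rintro _ ⟨i, rfl⟩; exact hxD i) hg hint)).trans
    ((ringKrullDim_le_of_surjective φ.rangeRestrict φ.rangeRestrict_surjective).trans ?_)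
  let _ : Field (R ⧸ IsLocalRing.maximalIdeal R) := Ideal.Quotient.field _
  rw [MvPolynomial.ringKrullDim_of_isNoetherianRing, ringKrullDim_eq_zero_of_field, zero_add,
    Nat.card_eq_fintype_card, Fintype.card_subtype_compl, Fintype.card_fin,
    Fintype.card_subtype_eq]

theorem ringKrullDim_quotient_le_of_isIntegral_adjoin {R E ι : Type*} [CommRing R] [IsLocalRing R]
    [CommRing E] [Algebra R E] {P : Ideal E}
    (hM : (IsLocalRing.maximalIdeal R).map (algebraMap R E) ≤ P) {g : ι → E}
    (hg : ∀ S : Subalgebra R E, (∀ y, g y ∈ S) → S = ⊤) {d : ℕ} {x : Fin d → E}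
    (hint : ∀ y, IsIntegral (Algebra.adjoin R (Set.range x)) (g y)) {i₀ : Fin d}
    (hi₀ : x i₀ ∈ P) : ringKrullDim (E ⧸ P) ≤ (d - 1 : ℕ) :=
  ringKrullDim_le_of_isIntegral_adjoin (Ideal.Quotient.mk P) Ideal.Quotient.mk_surjective
    (fun _ hr => Ideal.Quotient.eq_zero_iff_mem.2 (hM (Ideal.mem_map_of_mem _ hr))) hg hint
    (Ideal.Quotient.eq_zero_iff_mem.2 hi₀)

theorem ringKrullDim_quotient_add_one_le_of_bot_lt {A : Type*} [CommRing A] [IsDomain A]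
    {P : Ideal A} (h : ⊥ < P) : ringKrullDim (A ⧸ P) + 1 ≤ ringKrullDim A := by
  rw [← ringKrullDim_eq_of_ringEquiv (RingEquiv.quotientBot A)]
  exact ringKrullDim_quotient_add_one_le_of_lt h

section TopDimension

variable {R : Type u} [CommRing R] [IsLocalRing R] [IsNoetherianRing R]
  {L : Type v} [Field L] [Algebra R L] [IsFractionRing R L] {I : Ideal R} {d : ℕ}

/-- By Krull's height theorem an ideal with a reduction generated by `m` elements has height at most
`m`. -/
theorem ringKrullDim_le_of_isReduction (hrad : I.radical = IsLocalRing.maximalIdeal R) {n : ℕ}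
    (hn : 1 ≤ n) {m : ℕ} (y : Fin m → R)
    (h : IsReduction (Ideal.span (Set.range y)) (I ^ n)) : ringKrullDim R ≤ m := by
  classical
  obtain ⟨hle, k, hk⟩ := h
  have hpow : I ^ (n * (k + 1)) ≤ Ideal.span (Set.range y) := by
    rw [pow_mul, ← hk]
    exact Ideal.mul_le_left
  have hmin : IsLocalRing.maximalIdeal R ∈ (Ideal.span (Set.range y)).minimalPrimes := by
    refine ⟨⟨inferInstance, hle.trans ((Ideal.pow_le_self (by omega)).trans
      (hrad ▸ Ideal.le_radical))⟩, fun P' hP' _ => ?_⟩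
    rw [← hrad, hP'.1.radical_le_iff]
    exact hP'.1.le_of_pow_le (hpow.trans hP'.2)
  have hcoe : Set.range y = ((Finset.univ.image y : Finset R) : Set R) := by simp
  rw [hcoe] at hmin
  have h1 := (Ideal.height_le_card_of_mem_minimalPrimes_span_finset hmin).trans
    (Nat.cast_le.2 (Finset.card_image_le.trans (Finset.card_fin m).le))
  rw [← IsLocalRing.maximalIdeal_height_eq_ringKrullDim]
  exact WithBot.coe_le_coe.2 h1

omit [IsFractionRing R L] in
theorem mem_topDicriticals {V : dicriticalDivisors L I} : V ∈ topDicriticals L I d ↔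
    ringKrullDim (reesAlgebra I ⧸ dicriticalPrime V) = d := Iff.rfl

variable (hrad : I.radical = IsLocalRing.maximalIdeal R) (hI : IsNormalIdeal L I)
  (hI0 : I ≠ ⊥) (hd : ringKrullDim R = d)

/-- If `(x₁, …, x_d)` is a reduction of `I`, the Rees ring is integral over `R[x₁ Z, …, x_d Z]`;
so if `xᵢ Z ∈ P*` then `E / P*` is integral over an algebra generated by `d - 1` elements over the
residue field of `R`. -/
theorem ringKrullDim_quotient_le_of_isReduction [IsDomain R] {P : Ideal (reesAlgebra I)}
    (hI0 : I ≠ ⊥)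
    (hM : (IsLocalRing.maximalIdeal R).map (algebraMap R (reesAlgebra I)) ≤ P)
    (x : Fin d → I) (hx : IsReduction (Ideal.span (Set.range fun i => (x i : R))) I) (i₀ : Fin d)
    (hi₀ : reesDegreeOne (x i₀) ∈ P) : ringKrullDim (reesAlgebra I ⧸ P) ≤ (d - 1 : ℕ) :=
  ringKrullDim_quotient_le_of_isIntegral_adjoin hM (fun _ => eq_top_of_reesDegreeOne_mem)
    (isIntegral_reesDegreeOne hI0 x hx) hi₀

section Normal

variable [IsDomain R] [IsIntegrallyClosed R]

include hrad hI

theorem bot_lt_dicriticalPrime (V : dicriticalDivisors L I) : ⊥ < dicriticalPrime V := by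
  refine bot_lt_iff_ne_bot.2 fun h => ?_
  have h1 := height_dicriticalPrime hrad hI V
  rw [h, Ideal.height_bot] at h1
  exact zero_ne_one h1

theorem ringKrullDim_quotient_dicriticalPrime_add_one_le (V : dicriticalDivisors L I) :
    ringKrullDim (reesAlgebra I ⧸ dicriticalPrime V) + 1 ≤ ringKrullDim (reesAlgebra I) := by
  exact ringKrullDim_quotient_add_one_le_of_bot_lt (bot_lt_dicriticalPrime hrad hI V)

include hI0 hd

theorem ringKrullDim_quotient_dicriticalPrime_le (V : dicriticalDivisors L I) :
    ringKrullDim (reesAlgebra I ⧸ dicriticalPrime V) ≤ d :=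
  WithBot.le_of_add_one_le ((ringKrullDim_quotient_dicriticalPrime_add_one_le hrad hI V).trans
    (ringKrullDim_reesAlgebra_le hd hI0))

theorem ringKrullDim_quotient_le_of_mem_minimalPrimes {P : Ideal (reesAlgebra I)}
    (hP : P ∈ ((IsLocalRing.maximalIdeal R).map (algebraMap R (reesAlgebra I))).minimalPrimes) :
    ringKrullDim (reesAlgebra I ⧸ P) ≤ d := by
  rw [← range_dicriticalPrime hrad hI hI0] at hP
  obtain ⟨V, rfl⟩ := hP
  exact ringKrullDim_quotient_dicriticalPrime_le hrad hI hI0 hd V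

/-- If all the residue rings had dimension less than `d`, then some power of `I` would have a
reduction generated by `d - 1` elements. -/
theorem nonempty_topDicriticals : (topDicriticals L I d).Nonempty := by
  by_contra hempty
  have hd1 := one_le_of_ringKrullDim_eq hd hrad hI0
  obtain ⟨s, hs, y, -, h⟩ := exists_isReduction (I := I) le_rfl (Set.empty_subset _) (d - 1)
    fun P hP _ => by
      simp only [Set.mem_empty_iff_false, false_and, exists_false, Set.ofPred_false,
        Ideal.span_empty, sup_bot_eq] at hP
      refine WithBot.le_of_le_of_ne
        (ringKrullDim_quotient_le_of_mem_minimalPrimes hrad hI hI0 hd hP) fun he => hempty ?_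
      rw [← range_dicriticalPrime hrad hI hI0] at hP
      obtain ⟨V, rfl⟩ := hP
      exact ⟨V, he⟩
  have h1 := h 1 le_rfl
  rw [Set.image_empty, Set.empty_union] at h1
  have h2 := ringKrullDim_le_of_isReduction hrad (by omega) _ h1
  rw [hd] at h2
  have : d ≤ d - 1 := by exact_mod_cast h2
  omega

theorem ringKrullDim_reesAlgebra : ringKrullDim (reesAlgebra I) = d + 1 := by
  obtain ⟨V, hV⟩ := nonempty_topDicriticals (L := L) hrad hI hI0 hd
  refine le_antisymm (by exact_mod_cast ringKrullDim_reesAlgebra_le hd hI0) ?_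
  rw [← mem_topDicriticals.1 hV]
  exact ringKrullDim_quotient_dicriticalPrime_add_one_le hrad hI V

/-- A homogeneous element avoiding the top-dimensional dicritical primes lowers the dimension. -/
theorem ringKrullDim_quotient_le_of_mem_minimalPrimes_sup {r : ℕ} {x₁ : R} (hx₁ : x₁ ∈ I ^ r)
    (h : ∀ V ∈ topDicriticals L I d, reesMonomial hx₁ ∉ dicriticalPrime V)
    {P : Ideal (reesAlgebra I)}
    (hP : P ∈ ((IsLocalRing.maximalIdeal R).map (algebraMap R (reesAlgebra I)) ⊔
      Ideal.span {f | ∃ a ∈ ({x₁} : Set R), ∃ ha : a ∈ I ^ r, f = reesMonomial ha}).minimalPrimes) :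
    ringKrullDim (reesAlgebra I ⧸ P) ≤ (d - 1 : ℕ) := by
  have hd1 := one_le_of_ringKrullDim_eq hd hrad hI0
  have hxP : reesMonomial hx₁ ∈ P :=
    hP.1.2 (Ideal.mem_sup_right (Ideal.subset_span ⟨x₁, rfl, hx₁, rfl⟩))
  have := hP.1.1
  obtain ⟨P₀, hP₀, hle⟩ := Ideal.exists_minimalPrimes_le (le_sup_left.trans hP.1.2)
  rw [← range_dicriticalPrime hrad hI hI0] at hP₀
  obtain ⟨V, rfl⟩ := hP₀
  have := isPrime_dicriticalPrime V
  have hVd := ringKrullDim_quotient_dicriticalPrime_le hrad hI hI0 hd V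
  by_cases hV : V ∈ topDicriticals L I d
  · have hlt : dicriticalPrime V < P := lt_of_le_of_ne hle fun he => h V hV (he ▸ hxP)
    refine WithBot.le_of_add_one_le ((ringKrullDim_quotient_add_one_le_of_lt hlt).trans ?_)
    rwa [Nat.sub_add_cancel hd1]
  · exact (ringKrullDim_quotient_le_of_le hle).trans (WithBot.le_of_le_of_ne hVd hV)

theorem reesDegreeOne_notMem_of_isReduction (x : Fin d → I)
    (hx : IsReduction (Ideal.span (Set.range fun i => (x i : R))) I) (i : Fin d)
    {V : dicriticalDivisors L I} (hV : V ∈ topDicriticals L I d) :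
    reesDegreeOne (x i) ∉ dicriticalPrime V := by
  intro h
  have hd1 := one_le_of_ringKrullDim_eq hd hrad hI0
  have h1 := ringKrullDim_quotient_le_of_isReduction hI0
    (map_maximalIdeal_le_dicriticalPrime hrad hI V) x hx i h
  rw [mem_topDicriticals.1 hV] at h1
  have : d ≤ d - 1 := by exact_mod_cast h1
  omega

end Normal

end TopDimension

/-! ### Dimensions one and two -/

section ZariskisMainTheorem

variable {R A : Type*} [CommRing R] [CommRing A] [Algebra R A] [Algebra.FiniteType R A]

/-- A maximal ideal which is a minimal prime of an ideal contained in all the primes of its fibre is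
isolated in its fibre. -/
theorem quasiFiniteAt_of_mem_minimalPrimes [IsNoetherianRing A] {J Q : Ideal A}
    [hQp : Q.IsPrime] (hmax : Q.IsMaximal) (hQ : Q ∈ J.minimalPrimes)
    (hJ : ∀ P : Ideal A, P.IsPrime → P.comap (algebraMap R A) = Q.comap (algebraMap R A) → J ≤ P) :
    Algebra.QuasiFiniteAt R Q := by
  refine Algebra.QuasiFiniteAt.of_isOpen_singleton_fiber (R := R) ⟨Q, hQp⟩ ?_
  rw [isOpen_induced_iff]
  refine ⟨(⋃ P ∈ J.minimalPrimes \ {Q}, PrimeSpectrum.zeroLocus (P : Set A))ᶜ, ?_, ?_⟩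
  · exact (Set.Finite.isClosed_biUnion (J.finite_minimalPrimes_of_isNoetherianRing.subset
      Set.sdiff_subset) fun P _ => PrimeSpectrum.isClosed_zeroLocus _).isOpen_compl
  ext ⟨P, hP⟩
  have hPQ : P.asIdeal.comap (algebraMap R A) = Q.comap (algebraMap R A) :=
    congrArg PrimeSpectrum.asIdeal hP
  simp only [Set.mem_preimage, Set.mem_compl_iff, Set.mem_iUnion, PrimeSpectrum.mem_zeroLocus,
    Set.mem_singleton_iff, not_exists, Set.mem_sdiff]
  constructor
  · intro h
    obtain ⟨P₀, hP₀, hle⟩ := Ideal.exists_minimalPrimes_le (hJ _ P.2 hPQ)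
    obtain rfl : P₀ = Q := by
      by_contra hne
      exact h P₀ ⟨hP₀, hne⟩ hle
    exact Subtype.ext (PrimeSpectrum.ext (hmax.eq_of_le P.2.ne_top hle).symm)
  · rintro he P₀ ⟨hP₀, hne⟩ hle
    obtain rfl : P = ⟨Q, hQp⟩ := congrArg Subtype.val he
    have hle' : P₀ ≤ Q := hle
    exact hne (le_antisymm hle' (hQ.2 hP₀.1 hle'))

/-- Zariski's main theorem: `R` is local and integrally closed in `A`, so if `A` is quasi-finite
over `R` at a prime over the maximal ideal, then `A = R`. -/
theorem surjective_algebraMap_of_quasiFiniteAt [IsLocalRing R]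
    (hA : ∀ a : A, IsIntegral R a → ∃ r, algebraMap R A r = a) (Q : Ideal A) [Q.IsPrime]
    [Algebra.QuasiFiniteAt R Q]
    (hQ : ∀ r ∈ IsLocalRing.maximalIdeal R, algebraMap R A r ∈ Q) :
    Function.Surjective (algebraMap R A) := by
  obtain ⟨r, hrQ, hr, h⟩ := Algebra.zariskisMainProperty_iff.1
    (Algebra.ZariskisMainProperty.of_finiteType (R := R) Q)
  obtain ⟨r, rfl⟩ := hA r hr
  have hu : IsUnit r := by
    by_contra hu
    exact hrQ (hQ r ((IsLocalRing.mem_maximalIdeal r).2 hu))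
  obtain ⟨b, hb⟩ := isUnit_iff_exists_inv.1 hu
  intro a
  obtain ⟨m, hm⟩ := h a
  obtain ⟨c, hc⟩ := hA _ hm
  refine ⟨b ^ m * c, ?_⟩
  rw [map_mul, hc, ← mul_assoc, ← map_pow, ← map_mul, ← mul_pow, mul_comm b r, hb, one_pow, map_one,
    one_mul]

end ZariskisMainTheorem

theorem zero_le_ringKrullDim_quotient {A : Type*} [CommRing A] {P : Ideal A} (h : P ≠ ⊤) :
    0 ≤ ringKrullDim (A ⧸ P) :=
  have := Ideal.Quotient.nontrivial_iff.2 h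
  ringKrullDim_nonneg_of_nontrivial

section LowDimension

variable {R : Type u} [CommRing R] [IsLocalRing R] [IsNoetherianRing R]
  {L : Type v} [Field L] [Algebra R L] [IsFractionRing R L] {I : Ideal R}

/-- The map from the Rees ring to the chart given by `Z ↦ 1 / x`. -/
def reesToChart {x : R} (hx : x ∈ I) (hx0 : x ≠ 0) : reesAlgebra I →+* blowupChart L I x :=
  ((aeval (algebraMap R L x)⁻¹).toRingHom.comp (reesAlgebra I).val.toRingHom).codRestrict
    (blowupChart L I x) fun f => by
      change aeval (algebraMap R L x)⁻¹ (f : R[X]) ∈ blowupChart L I x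
      rw [aeval_eq_sum_range]
      refine sum_mem fun n _ => (mem_blowupChart_iff hx (algebraMap_frac_ne_zero hx0)).2
        ⟨n, _, f.2 n, ?_⟩
      rw [Algebra.smul_def, inv_pow, div_eq_mul_inv]

omit [IsLocalRing R] [IsNoetherianRing R] in
theorem reesToChart_reesMonomial {x : R} (hx : x ∈ I) (hx0 : x ≠ 0) {n : ℕ} {f : R}
    (hf : f ∈ I ^ n) : reesToChart hx hx0 (reesMonomial hf) =
      (chartElem hx hx0 hf : blowupChart L I x) := by
  refine Subtype.ext ?_
  change aeval (algebraMap R L x)⁻¹ (monomial n f) = algebraMap R L f / algebraMap R L x ^ n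
  rw [aeval_monomial, inv_pow, div_eq_mul_inv]

variable (hrad : I.radical = IsLocalRing.maximalIdeal R) (hI : IsNormalIdeal L I)

section

include hrad

omit [IsNoetherianRing R] in
theorem algebraMap_mem_of_isChart {V : ValuationSubring L} {x : R} {Q : Ideal (blowupChart L I x)}
    (h : IsChart I V x Q) {r : R} (hr : r ∈ IsLocalRing.maximalIdeal R) :
    algebraMap R (blowupChart L I x) r ∈ Q := by
  have := h.minimal.1.1
  rw [← valuation_lt_one_iff_mem h.eq]
  exact ((range_le_toLocalSubring_iff V).1 (range_le_of_isChart hrad h)).2 r hr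

end

/-- If `Q` is properly contained in a prime `Q'`, then `P*` is properly contained in the homogeneous
prime corresponding to `Q'`, and the latter in the maximal ideal generated by `M` and the irrelevant
ideal. -/
theorem IsChart.one_lt_ringKrullDim {V : dicriticalDivisors L I} {x : R}
    {Q Q' : Ideal (blowupChart L I x)} (h : IsChart I V.1 x Q) (hlt : Q < Q') [hQ' : Q'.IsPrime] :
    1 + 1 ≤ ringKrullDim (reesAlgebra I ⧸ dicriticalPrime V) := by
  have := isPrime_dicriticalPrime V
  let P := ((Q'.comap (reesToChart h.mem h.ne_zero)).homogeneousCore (reesGrading I)).toIdeal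
  have hP : P.IsPrime :=
    (inferInstance : (Q'.comap (reesToChart h.mem h.ne_zero)).IsPrime).homogeneousCore
  have hmem : ∀ {n : ℕ} {f : R} (hf : f ∈ I ^ n),
      reesMonomial hf ∈ P ↔ chartElem h.mem h.ne_zero hf ∈ Q' := fun {n f} hf => by
    rw [← reesToChart_reesMonomial, ← Ideal.mem_comap]
    exact ⟨fun hf' => Ideal.toIdeal_homogeneousCore_le _ _ hf', fun hf' =>
      Ideal.mem_homogeneousCore_of_homogeneous_of_mem ⟨n, reesMonomial_mem_reesGrading hf⟩ hf'⟩
  let P' : Ideal (reesAlgebra I) := (IsLocalRing.maximalIdeal R).comap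
    ((constantCoeff (R := R)).comp (reesAlgebra I).val.toRingHom)
  have hP' : P'.IsPrime := Ideal.IsPrime.comap _
  have h1 : dicriticalPrime V < P := by
    obtain ⟨hle, a, haQ', haQ⟩ := SetLike.lt_iff_le_and_exists.1 hlt
    refine lt_of_le_of_ne (dicriticalPrime_le_of_forall V fun hf hfV =>
      (hmem hf).2 (hle ((h.chartElem_mem_iff hf).2 hfV))) fun he => ?_
    obtain ⟨n, f, hf, rfl⟩ := exists_chartElem_eq h.mem h.ne_zero a
    rw [h.chartElem_mem_iff, he, hmem] at haQ
    exact haQ haQ'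
  have hx1 : x ∈ I ^ 1 := (pow_one I).symm ▸ h.mem
  have h2 : P < P' := by
    refine SetLike.lt_iff_le_and_exists.2 ⟨fun f hf => ?_, reesMonomial hx1, ?_, fun hx => ?_⟩
    · have hf0 : reesMonomial (f.2 0) ∈ P := by
        rw [← coe_decompose]
        exact (Ideal.homogeneousCore (reesGrading I) _).isHomogeneous 0 hf
      rw [hmem] at hf0
      change (f : R[X]).coeff 0 ∈ IsLocalRing.maximalIdeal R
      refine (IsLocalRing.mem_maximalIdeal _).2 fun hu => hQ'.ne_top
        (Q'.eq_top_of_isUnit_mem ?_ (hu.map (algebraMap R (blowupChart L I x))))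
      have e : algebraMap R (blowupChart L I x) ((f : R[X]).coeff 0) =
          chartElem h.mem h.ne_zero (f.2 0) :=
        Subtype.ext (by simp [chartElem, coe_algebraMap_blowupChart])
      rw [e]
      exact hf0
    · change (monomial 1 x : R[X]).coeff 0 ∈ IsLocalRing.maximalIdeal R
      rw [coeff_monomial, if_neg one_ne_zero]
      exact zero_mem _
    · rw [hmem] at hx
      refine hQ'.ne_top ((Ideal.eq_top_iff_one _).2 ?_)
      have hxL := algebraMap_frac_ne_zero (L := L) h.ne_zero
      have e : (1 : blowupChart L I x) = chartElem h.mem h.ne_zero hx1 :=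
        Subtype.ext (by simp [chartElem, hxL])
      rw [e]
      exact hx
  have h3 := zero_le_ringKrullDim_quotient hP'.ne_top
  calc (1 + 1 : WithBot ℕ∞) = 0 + 1 + 1 := by rw [zero_add]
    _ ≤ ringKrullDim (reesAlgebra I ⧸ P') + 1 + 1 := by gcongr
    _ ≤ ringKrullDim (reesAlgebra I ⧸ P) + 1 := by
      gcongr
      exact ringKrullDim_quotient_add_one_le_of_lt h2
    _ ≤ _ := ringKrullDim_quotient_add_one_le_of_lt h1

variable [IsDomain R] [IsIntegrallyClosed R]

include hrad hI

/-- In dimension one `R` itself is the only dicritical divisor. -/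
theorem mem_dicriticalDivisor_iff_of_ringKrullDim_eq_one (hd : ringKrullDim R = 1)
    (V : dicriticalDivisors L I) {z : L} : z ∈ V.1 ↔ ∃ r : R, algebraMap R L r = z := by
  have hdvr := isDiscreteValuationRing_of_ringKrullDim_eq_one R hd
  obtain ⟨x, Q, h⟩ := exists_isChart hrad hI V
  obtain ⟨hmem, hlt⟩ := (range_le_toLocalSubring_iff V.1).1 (range_le_of_isChart hrad h)
  refine ⟨fun hz => ?_, fun ⟨r, hr⟩ => hr ▸ hmem r⟩
  rcases ValuationRing.isInteger_or_isInteger R z with ⟨r, hr⟩ | ⟨r, hr⟩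
  · exact ⟨r, hr⟩
  by_cases hz0 : z = 0
  · exact ⟨0, by rw [hz0, map_zero]⟩
  have hu : IsUnit r := by
    by_contra hu
    have h1 := hlt r ((IsLocalRing.mem_maximalIdeal r).2 hu)
    have h2 := mul_lt_one_of_lt_of_le h1 ((V.1.valuation_le_one_iff z).2 hz)
    rw [← map_mul, hr, inv_mul_cancel₀ hz0, map_one] at h2
    exact lt_irrefl _ h2
  obtain ⟨b, hb⟩ := isUnit_iff_exists_inv.1 hu
  refine ⟨b, ?_⟩
  have h3 : algebraMap R L r * algebraMap R L b = 1 := by rw [← map_mul, hb, map_one]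
  rw [hr] at h3
  exact (eq_of_inv_mul_eq_one h3).symm ▸ rfl

theorem subsingleton_dicriticalDivisors (hd : ringKrullDim R = 1) :
    Subsingleton (dicriticalDivisors L I) :=
  ⟨fun V V' => Subtype.ext (SetLike.ext fun _ =>
    (mem_dicriticalDivisor_iff_of_ringKrullDim_eq_one hrad hI hd V).trans
      (mem_dicriticalDivisor_iff_of_ringKrullDim_eq_one hrad hI hd V').symm)⟩

/-- In dimension two the center of a dicritical divisor on a chart is not a closed point:
otherwise it would be isolated in its fibre, and the chart would be equal to `R` by Zariski's main
theorem; but `M` has height two, and the center has height one. -/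
theorem topDicriticals_eq_univ_of_ringKrullDim_eq_two (hI0 : I ≠ ⊥)
    (hd : ringKrullDim R = (2 : ℕ)) : topDicriticals L I 2 = Set.univ := by
  refine Set.eq_univ_of_forall fun V => ?_
  by_contra hV
  have hle1 := WithBot.le_of_le_of_ne (ringKrullDim_quotient_dicriticalPrime_le hrad hI hI0 hd V) hV
  obtain ⟨x, Q, h⟩ := exists_isChart hrad hI V
  have hQp := h.minimal.1.1
  have hQmax : Q.IsMaximal := by
    obtain ⟨Q', hQ', hle⟩ := Ideal.exists_le_maximal Q hQp.ne_top
    rcases hle.eq_or_lt with rfl | hlt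
    · exact hQ'
    have := hQ'.isPrime
    have h2 := (h.one_lt_ringKrullDim hlt).trans hle1
    exact absurd h2 (by decide)
  have hqf : Algebra.QuasiFiniteAt R Q := by
    refine quasiFiniteAt_of_mem_minimalPrimes hQmax h.minimal fun P _ hPQ => ?_
    rw [Ideal.span_singleton_le_iff_mem, ← Ideal.mem_comap, hPQ]
    exact h.minimal.1.2 (Ideal.mem_span_singleton_self _)
  have hsurj : Function.Surjective (algebraMap R (blowupChart L I x)) := by
    refine surjective_algebraMap_of_quasiFiniteAt (fun a ha => ?_) Q fun r =>
      algebraMap_mem_of_isChart hrad h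
    have haL : IsIntegral R (a : L) :=
      ha.map_of_comp_eq (RingHom.id R) (blowupChart L I x).subtype rfl
    obtain ⟨r, hr⟩ := IsIntegrallyClosed.isIntegral_iff.1 haL
    exact ⟨r, Subtype.ext hr⟩
  have hinj : Function.Injective (algebraMap R (blowupChart L I x)) := fun r s hrs =>
    IsFractionRing.injective R L (congrArg Subtype.val hrs)
  let e := RingEquiv.ofBijective (algebraMap R (blowupChart L I x)) ⟨hinj, hsurj⟩
  have hloc : IsLocalRing (blowupChart L I x) := e.isLocalRing
  have hdim := ringKrullDim_eq_of_ringEquiv e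
  rw [hd, ← IsLocalRing.maximalIdeal_height_eq_ringKrullDim,
    ← IsLocalRing.eq_maximalIdeal hQmax] at hdim
  have hht : Q.height ≤ 1 := Ideal.height_le_one_of_isPrincipal_of_mem_minimalPrimes _ Q h.minimal
  have : ((2 : ℕ) : WithBot ℕ∞) ≤ (1 : ℕ∞) := hdim ▸ WithBot.coe_le_coe.2 hht
  exact absurd this (by decide)

end LowDimension

end Dicritical

end

theorem mainTheorem1 {R : Type u} [CommRing R] [IsDomain R] [IsLocalRing R] [IsNoetherianRing R]
    [IsIntegrallyClosed R] {L : Type v} [Field L] [Algebra R L] [IsFractionRing R L]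
    (d : ℕ) (hd : ringKrullDim R = d) (I : Ideal R) (hI0 : I ≠ ⊥)
    (hIprim : I.IsPrimary) (hIrad : I.radical = IsLocalRing.maximalIdeal R)
    (hInormal : Dicritical.IsNormalIdeal L I) :
    -- (0) the dicritical set of `I` is a nonempty finite set of discrete valuation rings
    ((Dicritical.dicriticalSet L I).Finite ∧ (Dicritical.dicriticalSet L I).Nonempty ∧
      ∀ T ∈ Dicritical.dicriticalSet L I, IsDiscreteValuationRing T.toSubring) ∧
    -- (1)
    (Function.Injective
        (Dicritical.dicriticalPrime : Dicritical.dicriticalDivisors L I → Ideal (reesAlgebra I)) ∧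
      Set.range
        (Dicritical.dicriticalPrime : Dicritical.dicriticalDivisors L I → Ideal (reesAlgebra I)) =
        ((IsLocalRing.maximalIdeal R).map (algebraMap R (reesAlgebra I))).minimalPrimes ∧
      (∀ V : Dicritical.dicriticalDivisors L I, (Dicritical.dicriticalPrime V).height = 1) ∧
      IsGreatest (Set.range fun V : Dicritical.dicriticalDivisors L I =>
        ringKrullDim (reesAlgebra I ⧸ Dicritical.dicriticalPrime V)) d ∧
      ringKrullDim (reesAlgebra I) = d + 1) ∧
    -- (2)
    (∀ (V : Dicritical.dicriticalDivisors L I) (x : I),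
      Dicritical.value V.1 (x : R) = Dicritical.idealValue V.1 I ↔
        Dicritical.reesDegreeOne x ∉ Dicritical.dicriticalPrime V) ∧
    -- (3)
    (∀ x : Fin d → R, (∀ i, x i ∈ I) →
      Dicritical.IsReduction (Ideal.span (Set.range x)) I →
      ∀ i, ∀ V ∈ Dicritical.topDicriticals L I d,
        Dicritical.value V.1 (x i) = Dicritical.idealValue V.1 I) ∧
    -- (4)
    ((d = 1 → Nat.card (Dicritical.dicriticalDivisors L I) = 1 ∧
        Dicritical.topDicriticals L I d = Set.univ) ∧
      (d = 2 → Dicritical.topDicriticals L I d = Set.univ)) ∧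
    -- (5)
    (d = 1 → ∀ V : Dicritical.dicriticalDivisors L I, ∀ x ∈ I,
      (Dicritical.value V.1 x = Dicritical.idealValue V.1 I ↔
        Dicritical.IsReduction (Ideal.span {x}) I)) ∧
    -- (6)
    (∀ r : ℕ, 1 ≤ r → ∃ s : ℕ, 1 ≤ s ∧ ∃ x : Fin d → R, (∀ i, x i ∈ I ^ (r * s)) ∧
      ∀ t : ℕ, 1 ≤ t →
        Dicritical.IsReduction (Ideal.span (Set.range fun i => x i ^ t)) (I ^ (r * s * t))) ∧
    -- (7)
    (∀ r : ℕ, 1 ≤ r → ∀ x₁ ∈ I ^ r,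
      (∀ V ∈ Dicritical.topDicriticals L I d,
        Dicritical.value V.1 x₁ = Dicritical.idealValue V.1 (I ^ r)) →
      ∃ s : ℕ, 1 ≤ s ∧ ∃ y : Fin (d - 1) → R, (∀ i, y i ∈ I ^ (r * s)) ∧
        ∀ t : ℕ, 1 ≤ t →
          Dicritical.IsReduction
            (Ideal.span (insert (x₁ ^ (s * t)) (Set.range fun i => y i ^ t)))
            (I ^ (r * s * t))) ∧
    -- (8)
    (∀ r : ℕ, 1 ≤ r → ∃ s : ℕ, 1 ≤ s ∧ ∃ x₁ ∈ I ^ (r * s),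
      ∀ V ∈ Dicritical.topDicriticals L I d,
        Dicritical.value V.1 x₁ = Dicritical.idealValue V.1 (I ^ (r * s))) ∧
    -- (9)
    (Infinite (IsLocalRing.ResidueField R) →
      ∃ x : Fin d → R, (∀ i, x i ∈ I) ∧
        Dicritical.IsReduction (Ideal.span (Set.range x)) I) ∧
    -- (10)
    (Infinite (IsLocalRing.ResidueField R) → ∀ x₁ ∈ I,
      (∀ V ∈ Dicritical.topDicriticals L I d,
        Dicritical.value V.1 x₁ = Dicritical.idealValue V.1 I) →
      ∃ y : Fin (d - 1) → R, (∀ i, y i ∈ I) ∧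
        Dicritical.IsReduction (Ideal.span (insert x₁ (Set.range y))) I) ∧
    -- (11)
    ((∀ V : Dicritical.dicriticalDivisors L I, ∃ x ∈ I,
        Dicritical.value V.1 x = Dicritical.idealValue V.1 I) ∧
      (Infinite (IsLocalRing.ResidueField R) → ∃ x ∈ I,
        ∀ V : Dicritical.dicriticalDivisors L I,
          Dicritical.value V.1 x = Dicritical.idealValue V.1 I)) := by
  have hd1 : 1 ≤ d := Dicritical.one_le_of_ringKrullDim_eq hd hIrad hI0
  have hV : ∀ (V : Dicritical.dicriticalDivisors L I) (r : R), algebraMap R L r ∈ V.1 := fun V =>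
    Dicritical.algebraMap_mem_of_mem_dicriticalDivisors V.2
  have hdom := Dicritical.nonempty_dicriticalDivisors hIrad hInormal hI0
  have htop := Dicritical.nonempty_topDicriticals hIrad hInormal hI0 hd
  -- Without a prescribed first parameter one starts from the minimal primes of `M E` itself.
  have hempty : ∀ (r : ℕ) (P : Ideal (reesAlgebra I)),
      P ∈ ((IsLocalRing.maximalIdeal R).map (algebraMap R (reesAlgebra I)) ⊔ Ideal.span
        {f | ∃ a ∈ (∅ : Set R), ∃ ha : a ∈ I ^ r,
          f = Dicritical.reesMonomial ha}).minimalPrimes →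
      ¬ Set.range Dicritical.reesDegreeOne ⊆ (P : Set (reesAlgebra I)) →
        ringKrullDim (reesAlgebra I ⧸ P) ≤ d := fun r P hP _ => by
    simp only [Set.mem_empty_iff_false, false_and, exists_false, Set.ofPred_false,
      Ideal.span_empty, sup_bot_eq] at hP
    exact Dicritical.ringKrullDim_quotient_le_of_mem_minimalPrimes hIrad hInormal hI0 hd hP
  have hvalue : ∀ x₁ ∈ I, (∀ V ∈ Dicritical.topDicriticals L I d,
      Dicritical.value V.1 x₁ = Dicritical.idealValue V.1 I) → ∀ hx₁ : x₁ ∈ I ^ 1,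
      ∀ V ∈ Dicritical.topDicriticals L I d,
        Dicritical.reesMonomial hx₁ ∉ Dicritical.dicriticalPrime V := fun x₁ hx h hx₁ V hVt =>
    (Dicritical.value_eq_idealValue_iff hI0 V ⟨x₁, hx⟩).1 (h V hVt)
  have h3 : ∀ x : Fin d → R, (∀ i, x i ∈ I) →
      Dicritical.IsReduction (Ideal.span (Set.range x)) I →
      ∀ i, ∀ V ∈ Dicritical.topDicriticals L I d,
        Dicritical.value V.1 (x i) = Dicritical.idealValue V.1 I := fun x hx hred i V hVt =>
    (Dicritical.value_eq_idealValue_iff hI0 V ⟨x i, hx i⟩).2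
      (Dicritical.reesDegreeOne_notMem_of_isReduction hIrad hInormal hI0 hd
        (fun i => ⟨x i, hx i⟩) hred i hVt)
  have h4 : d = 1 → Subsingleton (Dicritical.dicriticalDivisors L I) := fun h =>
    Dicritical.subsingleton_dicriticalDivisors hIrad hInormal (by rw [hd, h]; rfl)
  -- The only dicritical divisor must be the one attaining the maximal dimension.
  have htop1 : d = 1 → Dicritical.topDicriticals L I d = Set.univ := fun h =>
    have := h4 h
    htop.eq_univ
  refine ⟨⟨Dicritical.finite_dicriticalSet hIrad hInormal hI0, ?_, fun T hT =>
      (Dicritical.exists_isChart_of_mem_dicriticalSet hIrad hInormal hT).1⟩,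
    ⟨Dicritical.injective_dicriticalPrime hIrad hInormal hI0,
      Dicritical.range_dicriticalPrime hIrad hInormal hI0,
      Dicritical.height_dicriticalPrime hIrad hInormal, ⟨?_, ?_⟩,
      Dicritical.ringKrullDim_reesAlgebra (L := L) hIrad hInormal hI0 hd⟩,
    Dicritical.value_eq_idealValue_iff hI0, h3, ⟨fun h => ⟨?_, htop1 h⟩, ?_⟩, ?_, ?_, ?_, ?_, ?_, ?_,
    ?_, ?_⟩
  · obtain ⟨V⟩ := hdom
    exact ⟨_, V.2⟩
  · obtain ⟨V, hV⟩ := htop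
    exact ⟨V, hV⟩
  · rintro _ ⟨V, rfl⟩
    exact Dicritical.ringKrullDim_quotient_dicriticalPrime_le hIrad hInormal hI0 hd V
  · exact Nat.card_eq_one_iff_unique.2 ⟨h4 h, hdom⟩
  · rintro rfl
    exact Dicritical.topDicriticals_eq_univ_of_ringKrullDim_eq_two hIrad hInormal hI0 hd
  · intro h V x hx
    have hx₁ : x ∈ I ^ 1 := (pow_one I).symm ▸ hx
    have := h4 h
    constructor
    · intro hVx
      have hne : ∀ V ∈ Dicritical.topDicriticals L I d,
          Dicritical.reesMonomial hx₁ ∉ Dicritical.dicriticalPrime V :=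
        hvalue x hx (fun V' _ => Subsingleton.elim V V' ▸ hVx) hx₁
      -- `x Z` is already a full system of parameters.
      refine Dicritical.isReduction_of_ringKrullDim_le_zero (Set.singleton_subset_iff.2 hx)
        fun P hP => ?_
      have := Dicritical.ringKrullDim_quotient_le_of_mem_minimalPrimes_sup hIrad hInormal hI0 hd
        hx₁ hne hP
      rwa [h] at this
    · intro hred
      subst h
      refine h3 (fun _ => x) (fun _ => hx) (by rwa [Set.range_const]) 0 V ?_
      rw [htop1 rfl]
      trivial
  · intro r hr
    obtain ⟨s, hs, y, hy, h⟩ := Dicritical.exists_isReduction hr (Set.empty_subset _) d (hempty r)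
    refine ⟨s, hs, y, hy, fun t ht => ?_⟩
    have := h t ht
    rwa [Set.image_empty, Set.empty_union] at this
  · intro r hr x₁ hx₁ hval
    obtain ⟨s, hs, y, hy, h⟩ := Dicritical.exists_isReduction hr
      (Set.singleton_subset_iff.2 hx₁) (d - 1) fun P hP _ =>
        Dicritical.ringKrullDim_quotient_le_of_mem_minimalPrimes_sup hIrad hInormal hI0 hd hx₁
          (fun V hVt => (Dicritical.value_eq_idealValue_pow_iff hI0 V hx₁).1 (hval V hVt)) hP
    refine ⟨s, hs, y, hy, fun t ht => ?_⟩
    have := h t ht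
    rwa [Set.image_singleton, Set.singleton_union] at this
  · intro r hr
    obtain ⟨f, ⟨n, hn, a, ha, rfl⟩, hP⟩ := Dicritical.exists_positiveMonomials_notMem
      (I := I) (Ideal.finite_minimalPrimes_of_isNoetherianRing _
        ((IsLocalRing.maximalIdeal R).map (algebraMap R (reesAlgebra I)))) fun P hP => by
      obtain ⟨y, hy⟩ := Dicritical.exists_reesDegreeOne_notMem_of_mem_minimalPrimes (L := L)
        hIrad hInormal hI0 hP
      exact ⟨hP.1.1, fun h => hy (h ⟨y, rfl⟩)⟩
    -- `s` is the degree `n` of a monomial avoiding all `P*`, and `x₁` the power `a ^ r`.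
    have har : a ^ r ∈ I ^ (r * n) := mul_comm r n ▸ Dicritical.pow_mem_ideal_pow ha r
    refine ⟨n, hn, a ^ r, har, fun V _ => ?_⟩
    rw [Dicritical.value_eq_idealValue_pow_iff hI0 V har,
      Dicritical.reesMonomial_congr (mul_comm r n) rfl
        (hb := Dicritical.pow_mem_ideal_pow ha r), ← Dicritical.reesMonomial_pow ha]
    exact fun h => hP _ (Dicritical.dicriticalPrime_mem_minimalPrimes hIrad hInormal V)
      ((Dicritical.isPrime_dicriticalPrime V).mem_of_pow_mem r h)
  · intro hinf
    obtain ⟨y, hy, h⟩ := Dicritical.exists_isReduction_of_infinite (I := I) (Set.empty_subset _) d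
      (hempty 1)
    rw [Set.empty_union] at h
    exact ⟨y, hy, h⟩
  · intro hinf x₁ hx hval
    have hx₁ : x₁ ∈ I ^ 1 := (pow_one I).symm ▸ hx
    obtain ⟨y, hy, h⟩ := Dicritical.exists_isReduction_of_infinite
      (Set.singleton_subset_iff.2 hx) (d - 1) fun P hP _ =>
        Dicritical.ringKrullDim_quotient_le_of_mem_minimalPrimes_sup hIrad hInormal hI0 hd hx₁
          (hvalue x₁ hx hval hx₁) hP
    rw [Set.singleton_union] at h
    exact ⟨y, hy, h⟩
  · intro V
    obtain ⟨x, hx, h⟩ := (Dicritical.idealValue_isGreatest V.1 (hV V) I).1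
    exact ⟨x, hx, h⟩
  · intro hinf
    have hfin := Ideal.finite_minimalPrimes_of_isNoetherianRing _
      ((IsLocalRing.maximalIdeal R).map (algebraMap R (reesAlgebra I)))
    obtain ⟨x, hx⟩ := Dicritical.exists_reesDegreeOne_notMem hfin.toFinset fun P hP =>
      ⟨(hfin.mem_toFinset.1 hP).1.2,
        Dicritical.exists_reesDegreeOne_notMem_of_mem_minimalPrimes (L := L) hIrad hInormal hI0
          (hfin.mem_toFinset.1 hP)⟩
    exact ⟨x, x.2, fun V => (Dicritical.value_eq_idealValue_iff hI0 V x).2 (hx _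
      (hfin.mem_toFinset.2 (Dicritical.dicriticalPrime_mem_minimalPrimes hIrad hInormal V)))⟩
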